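/- Let $\mathcal A$ be the ring of differential polynomials in three unknown functions $(u^1,u^2,u^3)=(u,v,w)$ of $x$: polynomials in the jet variables $u^{\alpha,s}=\partial_x^su^\alpha$ ($s\ge1$) whose coefficients are smooth functions of $(u,v,w)$ on $\{v\ne0,\ w\ne0\}$. Work in $\mathcal A[[\varepsilon]]$, with the shift operator $\Lambda=e^{\varepsilon\partial_x}=\sum_{n\ge0}\frac{\varepsilon^n}{n!}\partial_x^n$; every rational function of $\Lambda$ below is read as a formal power series in $\varepsilon\partial_x$. For $X=\sum_s a_s\Lambda^s$ put $X_+=\sum_{s\ge0}a_s\Lambda^s$, $X_-=\sum_{s\le-1}a_s\Lambda^s$, $\operatorname{Res}X=a_0$. Let $$A=\Lambda^2+u\Lambda+v,\quad B=1-w\Lambda^{-1},\quad L=B^{-1}A,\quad \tilde L=AB^{-1},\quad M=A^{-1}B,\quad \tilde M=BA^{-1},$$ where $B^{-1}$ is expanded in nonpositive and $A^{-1}$ in nonnegative powers of $\Lambda$, and let $L^{1/2},\tilde L^{1/2}$ be the square roots of $L,\tilde L$ of the form $\Lambda+\sum_{r\ge0}c_r\Lambda^{-r}$. The rational reduction of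 the 2D-Toda hierarchy of type $(2,1)$ consists of the flows, for $k\ge0$ and for $C=A$ and $C=B$, $$\varepsilon\frac{\partial C}{\partial t^{2,k}}=\frac{2^{k+1/2}}{(2k+1)!!}\Big((\tilde L^{k+1/2})_+C-C(L^{k+1/2})_+\Big),\qquad \varepsilon\frac{\partial C}{\partial t^{3,k}}=\frac{1}{(k+1)!}\Big((\tilde L^{k+1})_+C-C(L^{k+1})_+\Big),$$ $$\varepsilon\frac{\partial C}{\partial t^{0,-k-1}}=(-1)^kk!\Big((\tilde M^{k+1})_-C-C(M^{k+1})_-\Big),$$ and one puts $t^{0,0}=x$, $\partial/\partial t^{0,0}=\partial_x$. Let $$H_{2,k}=\frac{2^{k+3/2}}{(2k+3)!!}\int\operatorname{Res}L^{k+3/2}\,dx,\qquad H_{3,k}=\frac1{(k+2)!}\int\operatorname{Res}L^{k+2}\,dx\qquad(k\ge-1),$$ $$H_{0,-k-1}=(-1)^k(k-1)!\int\operatorname{Res}M^k\,dx\quad(k\ge1),\qquad H_{0,-1}=\int\log\frac wv\,dx$$ (with $\log|w/v|$ where $w/v<0$). The variational derivatives of $H=\int h\,dx$ are $\frac{\delta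 H}{\delta u^\alpha}=\sum_{s\ge0}(-\partial_x)^s\frac{\partial h}{\partial u^{\alpha,s}}$. Let $\mu_0=-\frac12$, $\mu_2=0$, $\mu_3=\frac12$ and $$\mathcal P_2=\begin{pmatrix}\Lambda v-v\Lambda^{-1}+u\frac{1-\Lambda}{1+\Lambda}u&0&u\frac{\Lambda-1}{1+\Lambda^{-1}}w\\ 0&0&v(\Lambda-1)w\\ w\frac{1-\Lambda^{-1}}{\Lambda+1}u&w(1-\Lambda^{-1})v&w\frac{\Lambda^2-\Lambda^{-1}}{\Lambda+1}w\end{pmatrix},$$ where the products are compositions of operators. **Theorem.** Let $i\in\{2,3\}$ and $k\ge0$, or $i=0$ and $k\le0$. The equations above determine $\frac{\partial}{\partial t^{i,k}}(u,v,w)\in\mathcal A[[\varepsilon]]^3$ uniquely (existence included), and $$\Big(k+\mu_i+\tfrac12\Big)\,\varepsilon\,\frac{\partial}{\partial t^{i,k}}\begin{pmatrix}u\\v\\w\end{pmatrix}=\mathcal P_2\begin{pmatrix}\delta H_{i,k-1}/\delta u\\ \delta H_{i,k-1}/\delta v\\ \delta H_{i,k-1}/\delta w\end{pmatrix}.$$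 For $(i,k)\ne(0,0)$ this equation is conversely equivalent to the equations of the flow $\partial/\partial t^{i,k}$. -/

import Mathlib

open scoped Manifold ContDiff

noncomputable section

namespace RR2T

/-! ### Differential polynomials in the unknown functions `(u, v, w) = (u⁰, u¹, u²)` -/

/-- The space of values `(u, v, w)`. -/
abbrev Vals : Type := Fin 3 → ℝ

/-- The open set of values on which `v ≠ 0` and `w ≠ 0`. -/
def U : TopologicalSpace.Opens Vals where
  carrier := {p | p 1 ≠ 0 ∧ p 2 ≠ 0}
  is_open' := (isOpen_ne_fun (continuous_apply 1) continuous_const).inter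
    (isOpen_ne_fun (continuous_apply 2) continuous_const)

/-- Smooth real functions on `U`. -/
abbrev Smooth : Type := C^∞⟮𝓘(ℝ, Vals), U; 𝓘(ℝ, ℝ), ℝ⟯

/-- A function on `U`, extended by zero to all values. -/
def ext0 (f : U → ℝ) : Vals → ℝ := Function.extend ((↑) : U → Vals) f 0

theorem ext0_coe (f : U → ℝ) (p : U) : ext0 f p = f p :=
  Subtype.val_injective.extend_apply f 0 p

theorem contDiffAt_ext0 (f : Smooth) (p : U) : ContDiffAt ℝ ∞ (ext0 f) p := by
  rw [← contMDiffAt_iff_contDiffAt, ← contMDiffAt_subtype_iff]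
  have h : (fun x : U => ext0 f x) = f := funext (ext0_coe f)
  rw [h]
  exact f.contMDiff p

theorem contMDiff_of_contDiffAt {g : Vals → ℝ} (h : ∀ p : U, ContDiffAt ℝ ∞ g p) :
    ContMDiff 𝓘(ℝ, Vals) 𝓘(ℝ, ℝ) ∞ (fun p : U => g p) := fun p =>
  contMDiffAt_subtype_iff.2 (contMDiffAt_iff_contDiffAt.2 (h p))

theorem ext0_add (f g : Smooth) : ext0 (f + g : Smooth) = ext0 f + ext0 g := by
  funext p
  by_cases hp : p ∈ U
  · lift p to U using hp
    simp [ext0_coe]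
  · have h : ∀ f : U → ℝ, ext0 f p = 0 := fun f =>
      Function.extend_apply' _ _ _ (by rintro ⟨q, rfl⟩; exact hp q.2)
    simp [h]

theorem ext0_smul (c : ℝ) (f : Smooth) : ext0 (c • f : Smooth) = c • ext0 f := by
  funext p
  by_cases hp : p ∈ U
  · lift p to U using hp
    simp [ext0_coe]
  · have h : ∀ f : U → ℝ, ext0 f p = 0 := fun f =>
      Function.extend_apply' _ _ _ (by rintro ⟨q, rfl⟩; exact hp q.2)
    simp [h]

/-- The partial derivative of a smooth function on `U` in the direction of the coordinate `α`. -/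
def basePartial (α : Fin 3) : Smooth →ₗ[ℝ] Smooth where
  toFun f := ⟨fun p => fderiv ℝ (ext0 f) p (Pi.single α 1),
    contMDiff_of_contDiffAt (g := fun p => fderiv ℝ (ext0 f) p (Pi.single α 1)) fun p =>
      ((contDiffAt_ext0 f p).fderiv_right (m := ∞) le_rfl).clm_apply contDiffAt_const⟩
  map_add' f g := by
    ext p
    have hf := (contDiffAt_ext0 f p).differentiableAt (by simp)
    have hg := (contDiffAt_ext0 g p).differentiableAt (by simp)
    change fderiv ℝ (ext0 (f + g : Smooth)) p _ = fderiv ℝ (ext0 f) p _ + fderiv ℝ (ext0 g) p _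
    rw [ext0_add, fderiv_add hf hg]
    rfl
  map_smul' c f := by
    ext p
    have hf := (contDiffAt_ext0 f p).differentiableAt (by simp)
    change fderiv ℝ (ext0 (c • f : Smooth)) p _ = c • fderiv ℝ (ext0 f) p _
    rw [ext0_smul, fderiv_const_smul hf]
    rfl

/-- The coordinate function `u^α` on `U`. -/
def baseCoord (α : Fin 3) : Smooth :=
  ⟨fun p => (p : Vals) α,
    contMDiff_of_contDiffAt (g := fun p => p α) fun _ => contDiffAt_pi.1 contDiffAt_id α⟩

/-- The function `log (w / v)` on `U` (where `w / v < 0`, this is `log |w / v|`). -/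
def baseLog : Smooth :=
  ⟨fun p => Real.log ((p : Vals) 2 / (p : Vals) 1),
    contMDiff_of_contDiffAt (g := fun p => Real.log (p 2 / p 1)) fun p =>
      ContDiffAt.log
        (ContDiffAt.div (f := fun q : Vals => q 2) (g := fun q : Vals => q 1)
          (contDiffAt_pi.1 contDiffAt_id 2) (contDiffAt_pi.1 contDiffAt_id 1) p.2.1)
        (div_ne_zero p.2.2 p.2.1)⟩

/-- Differential polynomials: polynomials in the jet variables `u^{α,s+1}`, written `X (α, s)`,
with coefficients in the smooth functions of `(u, v, w)`. -/
abbrev DiffPoly : Type := MvPolynomial (Fin 3 × ℕ) Smooth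

/-- `∂/∂u^{α,0}` : the derivative of the coefficients. -/
def coeffPartial (α : Fin 3) : DiffPoly →ₗ[ℝ] DiffPoly where
  toFun f := ∑ m ∈ f.support, MvPolynomial.monomial m (basePartial α (f.coeff m))
  map_add' f g := by
    classical
    ext1 n
    simp only [MvPolynomial.coeff_add, MvPolynomial.coeff_sum, MvPolynomial.coeff_monomial,
      Finset.sum_ite_eq', MvPolynomial.mem_support_iff]
    split_ifs <;> simp_all
    rename_i h1 h2 h3
    rw [← map_add, h1, map_zero]
  map_smul' c f := by
    classical
    ext1 n
    simp only [MvPolynomial.coeff_smul, MvPolynomial.coeff_sum, MvPolynomial.coeff_monomial,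
      Finset.sum_ite_eq', MvPolynomial.mem_support_iff, RingHom.id_apply]
    split_ifs <;> simp_all

/-- `∂/∂u^{α,s}`. -/
def jetPartial (α : Fin 3) : ℕ → DiffPoly →ₗ[ℝ] DiffPoly
  | 0 => coeffPartial α
  | s + 1 => ((MvPolynomial.pderiv (R := Smooth) (α, s)).toLinearMap).restrictScalars ℝ

/-- The total derivative
`∂_x = ∑_α u^{α,1} ∂/∂u^{α,0} + ∑_{α,s} u^{α,s+2} ∂/∂u^{α,s+1}`;
the second sum is the `Smooth`-linear derivation that maps `u^{α,s+1}` to `u^{α,s+2}`. -/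
def dx : DiffPoly →ₗ[ℝ] DiffPoly :=
  (∑ α : Fin 3, LinearMap.mulLeft ℝ (MvPolynomial.X (α, 0) : DiffPoly) ∘ₗ coeffPartial α) +
    ((MvPolynomial.mkDerivation Smooth
      (fun j : Fin 3 × ℕ => (MvPolynomial.X (j.1, j.2 + 1) : DiffPoly))).toLinearMap).restrictScalars ℝ

/-- The variational derivative `δ/δu^α = ∑_s (-∂_x)^s ∂/∂u^{α,s}` of a density
(only finitely many terms are nonzero). -/
def varDerivPoly (α : Fin 3) (h : DiffPoly) : DiffPoly :=
  ∑ᶠ s : ℕ, ((-dx) ^ s) (jetPartial α s h)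

/-! ### Formal power series in `ε` -/

/-- Formal power series in `ε` with differential polynomials as coefficients. -/
abbrev EpsRing : Type := PowerSeries DiffPoly

/-- The parameter `ε`. -/
def eps : EpsRing := PowerSeries.X

/-- A function of `(u, v, w)` as an element of `EpsRing`. -/
def ofSmooth (f : Smooth) : EpsRing := PowerSeries.C (MvPolynomial.C f)

/-- The unknown functions `u, v, w`, numbered `0, 1, 2`. -/
def coord (α : Fin 3) : EpsRing := ofSmooth (baseCoord α)

/-- The unknown function `u`. -/
def u : EpsRing := coord 0

/-- The unknown function `v`. -/
def v : EpsRing := coord 1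

/-- The unknown function `w`. -/
def w : EpsRing := coord 2

/-- The total derivative `∂_x`, acting on each coefficient in `ε`. -/
def dxEps (f : EpsRing) : EpsRing := PowerSeries.mk fun n => dx (PowerSeries.coeff n f)

/-- The variational derivative `δ/δu^α` of the local functional with density `h`,
acting on each coefficient in `ε`. -/
def varDeriv (α : Fin 3) (h : EpsRing) : EpsRing :=
  PowerSeries.mk fun n => varDerivPoly α (PowerSeries.coeff n h)

/-- The operator `φ(ε∂_x) = ∑_n φ_n ε^n ∂_x^n` of a formal power series `φ` in one variable. -/
def ofSymbol (φ : PowerSeries ℝ) : Module.End ℝ EpsRing where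
  toFun f := PowerSeries.mk fun N =>
    ∑ q ∈ Finset.HasAntidiagonal.antidiagonal N, PowerSeries.coeff q.1 φ • (dx ^ q.1) (PowerSeries.coeff q.2 f)
  map_add' f g := by
    ext1 N
    simp [smul_add, Finset.sum_add_distrib]
  map_smul' c f := by
    ext1 N
    simp [Finset.smul_sum, smul_comm c]

/-- The symbol `e^{jz}` of `Λ^j`. -/
def expSymbol (j : ℤ) : PowerSeries ℝ := PowerSeries.rescale (j : ℝ) (PowerSeries.exp ℝ)

/-- The power `Λ^j = e^{jε∂_x}` of the shift operator. -/
def shift (j : ℤ) : Module.End ℝ EpsRing := ofSymbol (expSymbol j)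

/-! ### Difference operators -/

/-- The formal difference operator `∑_n X_n Λ^n`, given by its coefficients. -/
abbrev DiffOp : Type := ℤ → EpsRing

/-- The composition of difference operators, from `aΛ^i ∘ bΛ^j = a (Λ^i b) Λ^{i+j}`. The sum is
finite if the powers of `Λ` in both factors are bounded above, or in both bounded below. -/
def comp (X Y : DiffOp) : DiffOp := fun n => ∑ᶠ i : ℤ, X i * shift i (Y (n - i))

/-- The operator `aΛ^j`. -/
def mono (a : EpsRing) (j : ℤ) : DiffOp := Pi.single j a

/-- The identity operator. -/
def idOp : DiffOp := mono 1 0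

/-- The powers of an operator. -/
def opPow (X : DiffOp) : ℕ → DiffOp
  | 0 => idOp
  | n + 1 => comp X (opPow X n)

/-- `X_+`, the part with the powers `Λ^n`, `n ≥ 0`. -/
def posPart (X : DiffOp) : DiffOp := fun n => if 0 ≤ n then X n else 0

/-- `X_-`, the part with the powers `Λ^n`, `n ≤ -1`. -/
def negPart (X : DiffOp) : DiffOp := fun n => if n ≤ -1 then X n else 0

/-- The residue, the coefficient of `Λ^0`. -/
def res (X : DiffOp) : EpsRing := X 0

/-- `A = Λ² + uΛ + v`. -/
def A : DiffOp := mono 1 2 + mono u 1 + mono v 0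

/-- `B = 1 - wΛ⁻¹`. -/
def B : DiffOp := mono 1 0 - mono w (-1)

/-- `B⁻¹`, the inverse of `B` among the series in nonpositive powers of `Λ`. -/
def Binv : DiffOp := Classical.epsilon fun Y : DiffOp =>
  (∀ n : ℤ, 0 < n → Y n = 0) ∧ comp B Y = idOp ∧ comp Y B = idOp

/-- `A⁻¹`, the inverse of `A` among the series in nonnegative powers of `Λ`. -/
def Ainv : DiffOp := Classical.epsilon fun Y : DiffOp =>
  (∀ n : ℤ, n < 0 → Y n = 0) ∧ comp A Y = idOp ∧ comp Y A = idOp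

/-- `L = B⁻¹A`. -/
def L : DiffOp := comp Binv A

/-- `L̃ = AB⁻¹`. -/
def Ltilde : DiffOp := comp A Binv

/-- `M = A⁻¹B`. -/
def M : DiffOp := comp Ainv B

/-- `M̃ = BA⁻¹`. -/
def Mtilde : DiffOp := comp B Ainv

/-- The square root of the form `Λ + ∑_{r ≥ 0} c_r Λ^{-r}` of an operator `X = Λ² + ⋯`. -/
def sqrtOp (X : DiffOp) : DiffOp := Classical.epsilon fun R : DiffOp =>
  (∀ n : ℤ, 1 < n → R n = 0) ∧ R 1 = 1 ∧ comp R R = X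

/-! ### The hierarchy -/

/-- The labels `i ∈ {0, 2, 3}` of the times `t^{i,k}`. -/
inductive Label : Type
  | zero
  | two
  | three

/-- The derivative `∂A/∂t = (∂u/∂t)Λ + ∂v/∂t` for `∂(u,v,w)/∂t = T`. -/
def dotA (T : Fin 3 → EpsRing) : DiffOp := mono (T 0) 1 + mono (T 1) 0

/-- The derivative `∂B/∂t = -(∂w/∂t)Λ⁻¹` for `∂(u,v,w)/∂t = T`. -/
def dotB (T : Fin 3 → EpsRing) : DiffOp := -mono (T 2) (-1)

/-- The equations `ε ∂A/∂t = c(QA - AP)` and `ε ∂B/∂t = c(QB - BP)` for `∂(u,v,w)/∂t = T`. -/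
def LaxPair (c : ℝ) (Q P : DiffOp) (T : Fin 3 → EpsRing) : Prop :=
  (∀ n, eps * dotA T n = c • (comp Q A n - comp A P n)) ∧
    ∀ n, eps * dotB T n = c • (comp Q B n - comp B P n)

/-- `T = ∂(u,v,w)/∂t^{i,k}` in the hierarchy. The times are `t^{2,k}` and `t^{3,k}` with `k ≥ 0`,
and `t^{0,k}` with `k ≤ 0`, where `t^{0,0} = x`. The half-integer power `X^{k+1/2}` is the
`(2k+1)`-st power of the square root of `X`; for `t^{0,-m}`, `m ≥ 1`, the equations have the
constant `(-1)^{m-1}(m-1)!` and the operators `M^m`, `M̃^m`. -/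
def IsFlow : Label → ℤ → (Fin 3 → EpsRing) → Prop
  | .two, k, T =>
    LaxPair ((2 : ℝ) ^ ((k : ℝ) + 1 / 2) / ((2 * k.toNat + 1).doubleFactorial : ℝ))
      (posPart (opPow (sqrtOp Ltilde) (2 * k.toNat + 1)))
      (posPart (opPow (sqrtOp L) (2 * k.toNat + 1))) T
  | .three, k, T =>
    LaxPair (1 / ((k.toNat + 1).factorial : ℝ))
      (posPart (opPow Ltilde (k.toNat + 1))) (posPart (opPow L (k.toNat + 1))) T
  | .zero, k, T =>
    if k = 0 then ∀ α, T α = dxEps (coord α)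
    else
      LaxPair ((-1) ^ ((-k).toNat - 1) * (((-k).toNat - 1).factorial : ℝ))
        (negPart (opPow Mtilde (-k).toNat)) (negPart (opPow M (-k).toNat)) T

/-- The density of the Hamiltonian `H_{i,k}`, for `i ∈ {2, 3}`, `k ≥ -1` and for `i = 0`, `k ≤ -1`.
For `k = -m-1` with `m ≥ 1`, that of `H_{0,k}` is `(-1)^m (m-1)! Res M^m`. -/
def hamDensity : Label → ℤ → EpsRing
  | .two, k =>
    ((2 : ℝ) ^ ((k : ℝ) + 3 / 2) / ((2 * k + 3).toNat.doubleFactorial : ℝ)) •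
      res (opPow (sqrtOp L) (2 * k + 3).toNat)
  | .three, k =>
    (1 / ((k + 2).toNat.factorial : ℝ)) • res (opPow L (k + 2).toNat)
  | .zero, k =>
    if k = -1 then ofSmooth baseLog
    else
      ((-1 : ℝ) ^ (-k - 1).toNat * (((-k - 1).toNat - 1).factorial : ℝ)) •
        res (opPow M (-k - 1).toNat)

/-- The constants `μ₀ = -1/2`, `μ₂ = 0`, `μ₃ = 1/2`. -/
def mu : Label → ℝ
  | .zero => -1 / 2
  | .two => 0
  | .three => 1 / 2

/-- The operator of multiplication by `a`. -/
def mult (a : EpsRing) : Module.End ℝ EpsRing := LinearMap.mulLeft ℝ a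

/-- The matrix of operators `𝒫₂`. A rational function of `Λ` stands for the power series in `ε∂_x`
that it is at `Λ = e^{ε∂_x}`; products are compositions of operators. -/
def P2 : Matrix (Fin 3) (Fin 3) (Module.End ℝ EpsRing) :=
  !![shift 1 * mult v - mult v * shift (-1)
        + mult u * ofSymbol ((1 - expSymbol 1) * (1 + expSymbol 1)⁻¹) * mult u,
      0,
      mult u * ofSymbol ((expSymbol 1 - 1) * (1 + expSymbol (-1))⁻¹) * mult w;
    0,
      0,
      mult v * (shift 1 - 1) * mult w;
    mult w * ofSymbol ((1 - expSymbol (-1)) * (expSymbol 1 + 1)⁻¹) * mult u,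
      mult w * (1 - shift (-1)) * mult v,
      mult w * ofSymbol ((expSymbol 2 - expSymbol (-1)) * (expSymbol 1 + 1)⁻¹) * mult w]

/-- The equation `(k + μ_i + 1/2) ε ∂(u,v,w)/∂t = 𝒫₂ δH_{i,k-1}` for `∂(u,v,w)/∂t = T`. -/
def SecondHamEq (i : Label) (k : ℤ) (T : Fin 3 → EpsRing) : Prop :=
  ∀ α : Fin 3, ((k : ℝ) + mu i + 1 / 2) • (eps * T α) =
    ∑ β : Fin 3, P2 α β (varDeriv β (hamDensity i (k - 1)))

end RR2T

end

noncomputable section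

namespace RR2T

/-! ### Difference operators over a commutative ring with an action of `ℤ` -/

/-! Write S = L^{1/2}. Take either X = S^n and X' = (BSB⁻¹)^n, which is the n-th power of the root
of L̃, or X = M^n and X' = M̃^n. In both cases there are operators Z and W, formally XA⁻¹ and XB⁻¹,
with ZA = WB = X and AZ = BW = X' (`Factorization`). They control both sides of the Hamiltonian
equation.

Gradients. Under the trace ∫Res, the variation of ∫Res X is a constant (n/2 for roots of L, -n for
M) times ∫Res(Z δA - W δB). So the gradient is that constant times g = (ΛZ₋₁, Z₀, Λ⁻¹W₁), which is
`gradVec`. To vary inverses and roots without expanding them, f ↦ f + δf is made a ring homomorphism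
into a square-zero extension. It commutes with the shifts and therefore acts on difference
operators, and the Euler operator annihilates total derivatives, which turns the residue into a
trace (`Ops.trace_mul_comm`, `trace_perturb_sqrt_pow`, `trace_perturb_quotient_pow`).

Flows. Because X'A = AX and X'B = BX, truncation leaves only the coefficients at Λ, 1 and Λ⁻¹ in
X'_+A - AX_+ and X'_+B - BX_+. Computing X₀ and X'₀ once from Z and once from W gives (Λ-1)(w g_w) =
(Λ²-1)Z₋₂ + (1-Λ⁻¹)(u g_u). Since 1+Λ is invertible, this can be solved for (Λ²-Λ)Z₋₂, and the
solution has exactly the rational coefficients of 𝒫₂ (`symbol_relation`, `ofSymbol_solve`). Hence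
the truncated commutators are the components of 𝒫₂g (`lax_A`, `lax_B`).

A flow is thus ε T = c 𝒫₂g, while the gradient of the Hamiltonian is κc g with κ = k + μ_i + 1/2
(`flow_of_iff`). Existence follows because 𝒫₂ is divisible by ε, uniqueness because ε can be
cancelled, and the converse because κ ≠ 0. For t^{0,0} the factor κ vanishes and ∫log(w/v) is a
Casimir. -/

/-- An action of `ℤ` on a commutative ring by ring endomorphisms. -/
structure ShiftAction (K : Type*) [CommRing K] where
  /-- The endomorphism by which `j` acts. -/
  σ : ℤ → K →+* K
  zero_apply : ∀ x, σ 0 x = x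
  add_apply : ∀ i j x, σ (i + j) x = σ i (σ j x)

namespace ShiftAction

variable {K : Type*} [CommRing K] (s : ShiftAction K)

theorem neg_apply_apply (i : ℤ) (x : K) : s.σ (-i) (s.σ i x) = x := by
  rw [← s.add_apply, neg_add_cancel, s.zero_apply]

theorem apply_neg_apply (i : ℤ) (x : K) : s.σ i (s.σ (-i) x) = x := by
  rw [← s.add_apply, add_neg_cancel, s.zero_apply]

/-- The composition of difference operators. -/
def gcomp (X Y : ℤ → K) : ℤ → K := fun n => ∑ᶠ i : ℤ, X i * s.σ i (Y (n - i))

end ShiftAction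

/-- The sign e lets one argument serve both expansions: e = 1 for series that descend in powers of Λ
(`Binv`, the roots), e = -1 for series that ascend (`Ainv`). -/
theorem finite_units_mul_mem_Icc (e : ℤˣ) (a b : ℤ) : {i : ℤ | a ≤ e * i ∧ e * i ≤ b}.Finite := by
  rcases Int.units_eq_one_or e with rfl | rfl
  · exact (Set.finite_Icc a b).subset fun i hi => by simpa using hi
  · refine (Set.finite_Icc (-b) (-a)).subset fun i hi => ?_
    simp only [Units.val_neg, Units.val_one, Set.mem_ofPred_eq] at hi
    constructor <;> linarith [hi.1, hi.2]

/-- The operators in which the powers `Λ^n` have `e * n` bounded above. -/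
def boundedOps (K : Type*) [CommRing K] (e : ℤˣ) : AddSubgroup (ℤ → K) where
  carrier := {X | ∃ N : ℤ, ∀ n, N < e * n → X n = 0}
  zero_mem' := ⟨0, fun _ _ => rfl⟩
  add_mem' := by
    rintro X Y ⟨N, hN⟩ ⟨N', hN'⟩
    exact ⟨max N N', fun n hn => by
      simp [hN n (lt_of_le_of_lt (le_max_left _ _) hn),
        hN' n (lt_of_le_of_lt (le_max_right _ _) hn)]⟩
  neg_mem' := by
    rintro X ⟨N, hN⟩
    exact ⟨N, fun n hn => by simp [hN n hn]⟩

/-! ### The ring of operators with powers bounded on one side -/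

section Bounded

variable {K : Type*} [CommRing K] (s : ShiftAction K) (e : ℤˣ)

theorem finite_support_gcomp_term {X Y : ℤ → K} (hX : X ∈ boundedOps K e)
    (hY : Y ∈ boundedOps K e) (n : ℤ) :
    (Function.support fun i => X i * s.σ i (Y (n - i))).Finite := by
  obtain ⟨N, hN⟩ := hX
  obtain ⟨N', hN'⟩ := hY
  refine (finite_units_mul_mem_Icc e (e * n - N') N).subset fun i hi => ?_
  by_contra h
  apply hi
  simp only [Set.mem_ofPred_eq, not_and_or, not_le] at h
  rcases h with h | h
  · simp [hN' (n - i) (by rw [mul_sub]; linarith)]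
  · simp [hN i h]

theorem gcomp_mem {X Y : ℤ → K} (hX : X ∈ boundedOps K e) (hY : Y ∈ boundedOps K e) :
    s.gcomp X Y ∈ boundedOps K e := by
  obtain ⟨N, hN⟩ := hX
  obtain ⟨N', hN'⟩ := hY
  refine ⟨N + N', fun n hn => ?_⟩
  unfold ShiftAction.gcomp
  refine (finsum_congr fun i => ?_).trans finsum_zero
  by_cases h : N < e * i
  · simp [hN i h]
  · simp [hN' (n - i) (by rw [mul_sub]; linarith)]

/-- Both sides are iterated sums of one function of two indices. The bounds on the three factors
confine its support to a finite set of pairs, so the order of summation can be exchanged. -/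
theorem gcomp_assoc {X Y Z : ℤ → K} (hX : X ∈ boundedOps K e) (hY : Y ∈ boundedOps K e)
    (hZ : Z ∈ boundedOps K e) : s.gcomp (s.gcomp X Y) Z = s.gcomp X (s.gcomp Y Z) := by
  funext n
  have hl : s.gcomp (s.gcomp X Y) Z n
      = ∑ᶠ i, ∑ᶠ j, X j * s.σ j (Y (i - j)) * s.σ i (Z (n - i)) := by
    refine finsum_congr fun i => ?_
    exact finsum_mul' _ _ (finite_support_gcomp_term s e hX hY i)
  have hr : s.gcomp X (s.gcomp Y Z) n
      = ∑ᶠ j, ∑ᶠ i, X j * s.σ j (Y (i - j)) * s.σ i (Z (n - i)) := by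
    refine finsum_congr fun j => ?_
    have h1 : s.σ j (s.gcomp Y Z (n - j))
        = ∑ᶠ l, s.σ j (Y l * s.σ l (Z (n - j - l))) :=
      (s.σ j).toAddMonoidHom.map_finsum (finite_support_gcomp_term s e hY hZ (n - j))
    have h2 : (Function.support fun l => s.σ j (Y l * s.σ l (Z (n - j - l)))).Finite :=
      (finite_support_gcomp_term s e hY hZ (n - j)).subset
        fun l hl h => hl (by
          change s.σ j (Y l * s.σ l (Z (n - j - l))) = 0
          rw [show Y l * s.σ l (Z (n - j - l)) = 0 from h, map_zero])
    rw [h1, mul_finsum' _ _ h2, ← finsum_comp_equiv (Equiv.subRight j)]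
    refine finsum_congr fun i => ?_
    simp only [Equiv.subRight_apply, map_mul, ← s.add_apply]
    rw [show j + (i - j) = i by ring, show n - j - (i - j) = n - i by ring, mul_assoc]
  rw [hl, hr]
  set F : ℤ × ℤ → K := fun p => X p.2 * s.σ p.2 (Y (p.1 - p.2)) * s.σ p.1 (Z (n - p.1)) with hF
  have hfin : (Function.support F).Finite := by
    obtain ⟨N, hN⟩ := hX
    obtain ⟨M, hM⟩ := hY
    obtain ⟨P, hP⟩ := hZ
    refine ((finite_units_mul_mem_Icc e (e * n - P) (N + M)).prod
      (finite_units_mul_mem_Icc e (e * n - P - M) N)).subset fun p hp => ?_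
    by_contra h
    apply hp
    have key : N < e * p.2 ∨ M < e * (p.1 - p.2) ∨ P < e * (n - p.1) := by
      by_contra hc
      simp only [not_or, not_lt, mul_sub] at hc
      exact h ⟨⟨by linarith, by linarith⟩, by linarith, by linarith⟩
    rcases key with h | h | h
    · simp [hF, hN _ h]
    · simp [hF, hM _ h]
    · simp [hF, hP _ h]
  have hfin' : (Function.support fun q : ℤ × ℤ => F q.swap).Finite := by
    refine (hfin.preimage (f := Prod.swap) Prod.swap_injective.injOn).subset fun q hq => hq
  exact (finsum_curry F hfin).symm.trans
    ((finsum_comp_equiv (Equiv.prodComm ℤ ℤ)).symm.trans (finsum_curry _ hfin'))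

/-- The ring of difference operators in which the powers `Λ^n` have `e * n` bounded above. -/
def Ops (_s : ShiftAction K) (e : ℤˣ) : Type _ := boundedOps K e

/-- The additive group of difference operators. -/
abbrev Ops.addCommGroup : AddCommGroup (Ops s e) :=
  inferInstanceAs (AddCommGroup (boundedOps K e))

variable {s e}

/-- The coefficients of an operator. -/
def Ops.coeff (X : Ops s e) : ℤ → K := X.1

theorem Ops.ext {X Y : Ops s e} (h : ∀ n, X.coeff n = Y.coeff n) : X = Y :=
  Subtype.ext (funext h)

theorem Ops.coeff_injective {X Y : Ops s e} (h : X.coeff = Y.coeff) : X = Y := Subtype.ext h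

theorem mono_mem (a : K) (j : ℤ) : Pi.single j a ∈ boundedOps K e :=
  ⟨e * j, fun n hn => Pi.single_eq_of_ne (by rintro rfl; exact lt_irrefl _ hn) _⟩

theorem gcomp_single_left (a : K) (j : ℤ) (X : ℤ → K) (n : ℤ) :
    s.gcomp (Pi.single j a) X n = a * s.σ j (X (n - j)) := by
  unfold ShiftAction.gcomp
  rw [finsum_eq_single _ j fun i hi => by simp [Pi.single_eq_of_ne hi]]
  simp

theorem gcomp_single_right (a : K) (j : ℤ) (X : ℤ → K) (n : ℤ) :
    s.gcomp X (Pi.single j a) n = X (n - j) * s.σ (n - j) a := by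
  unfold ShiftAction.gcomp
  rw [finsum_eq_single _ (n - j) fun i hi => by
    rw [Pi.single_eq_of_ne (by intro h; apply hi; linarith)]; simp]
  simp

instance : Ring (Ops s e) where
  __ := Ops.addCommGroup s e
  mul X Y := ⟨s.gcomp X.1 Y.1, gcomp_mem s e X.2 Y.2⟩
  one := ⟨Pi.single 0 1, mono_mem 1 0⟩
  mul_assoc X Y Z := Subtype.ext (gcomp_assoc s e X.2 Y.2 Z.2)
  one_mul X := Subtype.ext (funext fun n =>
    (gcomp_single_left 1 0 X.1 n).trans (by simp [s.zero_apply]))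
  mul_one X := Subtype.ext (funext fun n =>
    (gcomp_single_right 1 0 X.1 n).trans (by simp))
  zero_mul X := Subtype.ext (funext fun n =>
    (finsum_congr fun i => zero_mul _).trans finsum_zero)
  mul_zero X := Subtype.ext (funext fun n =>
    (finsum_congr fun i => by
      change X.1 i * s.σ i 0 = 0
      simp).trans finsum_zero)
  left_distrib X Y Z := Subtype.ext (funext fun n => by
    refine Eq.trans (finsum_congr fun i => ?_)
      (finsum_add_distrib (finite_support_gcomp_term s e X.2 Y.2 n)
        (finite_support_gcomp_term s e X.2 Z.2 n))
    change X.1 i * s.σ i (Y.1 (n - i) + Z.1 (n - i)) = _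
    rw [map_add, mul_add])
  right_distrib X Y Z := Subtype.ext (funext fun n => by
    refine Eq.trans (finsum_congr fun i => ?_)
      (finsum_add_distrib (finite_support_gcomp_term s e X.2 Z.2 n)
        (finite_support_gcomp_term s e Y.2 Z.2 n))
    exact add_mul _ _ _)

namespace Ops

/-- The operators are functorial in the ring. -/
def map {K' : Type*} [CommRing K'] {s' : ShiftAction K'} (f : K →+* K')
    (hf : ∀ i x, f (s.σ i x) = s'.σ i (f x)) (e : ℤˣ) : Ops s e →+* Ops s' e where
  toFun X := ⟨fun n => f (X.coeff n), X.2.imp fun N hN n hn => by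
    change f (X.1 n) = 0
    rw [hN n hn, map_zero]⟩
  map_one' := Ops.ext fun n => by
    change f (Pi.single (M := fun _ => K) 0 1 n) = Pi.single (M := fun _ => K') 0 1 n
    by_cases h : n = 0
    · subst h; simp
    · simp [Pi.single_eq_of_ne h]
  map_mul' X Y := Ops.ext fun n => by
    change f (∑ᶠ i, X.coeff i * s.σ i (Y.coeff (n - i))) = ∑ᶠ i, _
    rw [show f (∑ᶠ i, X.coeff i * s.σ i (Y.coeff (n - i)))
        = ∑ᶠ i, f (X.coeff i * s.σ i (Y.coeff (n - i))) from
      f.toAddMonoidHom.map_finsum (finite_support_gcomp_term s e X.2 Y.2 n)]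
    exact finsum_congr fun i => by rw [map_mul, hf]
  map_zero' := Ops.ext fun n => map_zero f
  map_add' X Y := Ops.ext fun n => map_add f _ _

/-- A functional invariant under the shifts, composed with the residue, is a trace. -/
theorem trace_mul_comm {V : Type*} [AddCommGroup V] (τ : K →+ V) (hτ : ∀ i x, τ (s.σ i x) = τ x)
    (X Y : Ops s e) : τ ((X * Y).coeff 0) = τ ((Y * X).coeff 0) := by
  have h : ∀ X Y : Ops s e, τ ((X * Y).coeff 0)
      = ∑ᶠ i, τ (X.coeff i * s.σ i (Y.coeff (0 - i))) := fun X Y =>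
    τ.map_finsum (finite_support_gcomp_term s e X.2 Y.2 0)
  rw [h, h, ← finsum_comp_equiv (Equiv.neg ℤ)]
  refine finsum_congr fun i => ?_
  -- Applying Λ^i under τ turns X_{-i} Λ^{-i}(Y_i) into Y_i Λ^i(X_{-i}), which is the corresponding
  -- term of YX.
  rw [← hτ i, map_mul]
  simp only [Equiv.neg_apply, zero_sub, neg_neg, s.apply_neg_apply]
  rw [mul_comm]

end Ops

/-! ### Inverses and square roots -/

theorem gcomp_apply_of_lt {X Y : ℤ → K} {d d' : ℤ} (hX : ∀ n, 0 < e * (n - d) → X n = 0)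
    (hY : ∀ n, 0 < e * (n - d') → Y n = 0) {n : ℤ} (hn : 0 < e * (n - (d + d'))) :
    s.gcomp X Y n = 0 := by
  refine (finsum_congr fun i => ?_).trans finsum_zero
  by_cases h : 0 < e * (i - d)
  · simp [hX i h]
  · rw [hY (n - i) (by
      have : (e : ℤ) * (n - i - d') = e * (n - (d + d')) - e * (i - d) := by ring
      linarith)]
    simp

/-- Counted from the leading powers in the direction of expansion, composition is a Cauchy product
twisted by shifts. The recursions for inverses and roots run on this form. -/
theorem gcomp_apply_sub {X Y : ℤ → K} {d d' : ℤ} (hX : ∀ n, 0 < e * (n - d) → X n = 0)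
    (hY : ∀ n, 0 < e * (n - d') → Y n = 0) (k : ℕ) :
    s.gcomp X Y (d + d' - e * k)
      = ∑ q ∈ Finset.HasAntidiagonal.antidiagonal k, X (d - e * q.1) * s.σ (d - e * q.1) (Y (d' - e * q.2)) := by
  have he : (e : ℤ) * e = 1 := by rcases Int.units_eq_one_or e with rfl | rfl <;> simp
  have hinj : Function.Injective fun a : ℕ => d - (e : ℤ) * a := fun a b hab => by
    have h : (e : ℤ) * a = e * b := by simpa using hab
    have : (e : ℤ) * (e * a) = e * (e * b) := by rw [h]
    rw [← mul_assoc, ← mul_assoc, he] at this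
    simpa using this
  have hsub : (Function.support fun i => X i * s.σ i (Y (d + d' - e * k - i)))
      ⊆ ((Finset.range (k + 1)).map ⟨_, hinj⟩ : Finset ℤ) := by
    intro i hi
    have h1 : (e : ℤ) * (i - d) ≤ 0 := by
      by_contra h
      exact hi (by simp [hX i (not_le.1 h)])
    have h2 : (e : ℤ) * (d + d' - e * k - i - d') ≤ 0 := by
      by_contra h
      exact hi (by simp [hY _ (not_le.1 h)])
    have h3 : (e : ℤ) * (d + d' - e * k - i - d') = -(e * (i - d)) - (e * e) * k := by ring
    rw [h3, he] at h2
    simp only [Finset.coe_map, Function.Embedding.coeFn_mk, Set.mem_image, Finset.coe_range,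
      Set.mem_Iio]
    refine ⟨(-(e * (i - d))).toNat, by omega, ?_⟩
    rw [Int.toNat_of_nonneg (by omega)]
    linear_combination (i - d) * he
  unfold ShiftAction.gcomp
  rw [finsum_eq_sum_of_support_subset _ hsub, Finset.sum_map,
    Finset.Nat.sum_antidiagonal_eq_sum_range_succ_mk]
  refine Finset.sum_congr rfl fun a ha => ?_
  have : (d + d' - e * k - (d - e * a) : ℤ) = d' - e * ((k - a : ℕ) : ℤ) := by
    rw [Nat.cast_sub (by simpa [Nat.lt_succ_iff] using ha)]
    ring
  simp only [Function.Embedding.coeFn_mk, this]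

theorem exists_strong_rec {α : Type*} (F : ∀ n : ℕ, (∀ m < n, α) → α) :
    ∃ y : ℕ → α, ∀ n, y n = F n fun m _ => y m :=
  ⟨fun n => Nat.strongRec (motive := fun _ => α) F n, fun n => by
    change Nat.strongRec (motive := fun _ => α) F n = _
    rw [Nat.strongRec_eq]⟩

/-- The operator with leading power `Λ^d` and given coefficients. -/
def ofSeq (e : ℤˣ) (d : ℤ) (y : ℕ → K) : ℤ → K := fun n =>
  if 0 < e * (n - d) then 0 else y (-(e * (n - d))).toNat

theorem ofSeq_of_lt (d : ℤ) (y : ℕ → K) {n : ℤ} (h : 0 < e * (n - d)) : ofSeq e d y n = 0 :=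
  if_pos h

theorem ofSeq_sub (d : ℤ) (y : ℕ → K) (k : ℕ) : ofSeq e d y (d - e * k) = y k := by
  have he : (e : ℤ) * e = 1 := by rcases Int.units_eq_one_or e with rfl | rfl <;> simp
  have : (e : ℤ) * (d - e * k - d) = -k := by linear_combination (-(k : ℤ)) * he
  simp only [ofSeq, this]
  rw [if_neg (by omega), neg_neg, Int.toNat_natCast]

theorem eq_sub_of_not_lt {n d : ℤ} (h : ¬0 < e * (n - d)) :
    ∃ k : ℕ, n = d - e * k := by
  have he : (e : ℤ) * e = 1 := by rcases Int.units_eq_one_or e with rfl | rfl <;> simp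
  refine ⟨(-(e * (n - d))).toNat, ?_⟩
  rw [Int.toNat_of_nonneg (by omega)]
  linear_combination (d - n) * he

theorem mem_boundedOps_of_lt {X : ℤ → K} {d : ℤ} (hX : ∀ n, 0 < e * (n - d) → X n = 0) :
    X ∈ boundedOps K e :=
  ⟨e * d, fun n hn => hX n (by rw [mul_sub]; linarith)⟩

/-- The equation XY = 1 is triangular: its k-th coefficient is X_d Λ^d(y_k) plus terms in y_j with j
< k, so inverting X_d and applying Λ^{-d} determines y_k. The leading coefficient of Y is recorded
as a unit so that the lemma applies to Y as well. -/
theorem exists_right_inverse {X : ℤ → K} {d : ℤ} (hX : ∀ n, 0 < e * (n - d) → X n = 0)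
    (hd : IsUnit (X d)) :
    ∃ Y : ℤ → K, (∀ n, 0 < e * (n - -d) → Y n = 0) ∧ IsUnit (Y (-d)) ∧
      s.gcomp X Y = Pi.single 0 1 := by
  obtain ⟨a, ha⟩ := hd.exists_right_inv
  obtain ⟨y, hy⟩ := exists_strong_rec fun (n : ℕ) (z : ∀ m < n, K) =>
    s.σ (-d) (a * ((if n = 0 then 1 else 0) - ∑ q ∈ (Finset.HasAntidiagonal.antidiagonal n).attach,
      if h : q.1.2 < n then X (d - e * q.1.1) * s.σ (d - e * q.1.1) (z q.1.2 h) else 0))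
  have hy0 : y 0 = s.σ (-d) a := by
    rw [hy]
    congr 1
    rw [if_pos rfl, Finset.sum_eq_zero fun q _ => by simp, sub_zero, mul_one]
  have heq : ∀ k : ℕ, ∑ q ∈ Finset.HasAntidiagonal.antidiagonal k,
      X (d - e * q.1) * s.σ (d - e * q.1) (y q.2) = if k = 0 then 1 else 0 := by
    intro k
    have h1 : ∑ q ∈ Finset.HasAntidiagonal.antidiagonal k, X (d - e * q.1) * s.σ (d - e * q.1) (y q.2)
        = X d * s.σ d (y k) + ∑ q ∈ Finset.HasAntidiagonal.antidiagonal k,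
          if q.2 < k then X (d - e * q.1) * s.σ (d - e * q.1) (y q.2) else 0 := by
      rw [← Finset.add_sum_erase _ _ (show ((0, k) : ℕ × ℕ) ∈ Finset.HasAntidiagonal.antidiagonal k by simp),
        ← Finset.add_sum_erase _ (fun q : ℕ × ℕ =>
          if q.2 < k then X (d - e * q.1) * s.σ (d - e * q.1) (y q.2) else 0)
          (show ((0, k) : ℕ × ℕ) ∈ Finset.HasAntidiagonal.antidiagonal k by simp)]
      simp only [Nat.cast_zero, mul_zero, sub_zero, lt_irrefl, if_false, zero_add]
      congr 1
      refine Finset.sum_congr rfl fun q hq => ?_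
      rw [if_pos]
      rw [Finset.mem_erase, Finset.HasAntidiagonal.mem_antidiagonal] at hq
      by_contra h
      exact hq.1 (Prod.ext (by change q.1 = 0; omega) (by change q.2 = k; omega))
    rw [h1, hy k, s.apply_neg_apply, ← mul_assoc, ha, one_mul,
      Finset.sum_attach (Finset.HasAntidiagonal.antidiagonal k) (fun q : ℕ × ℕ =>
        if _ : q.2 < k then X (d - e * q.1) * s.σ (d - e * q.1) (y q.2) else 0)]
    simp only [dite_eq_ite, sub_add_cancel]
  refine ⟨ofSeq e (-d) y, fun n hn => ofSeq_of_lt _ _ hn, ?_, funext fun n => ?_⟩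
  · have := ofSeq_sub (e := e) (-d) y 0
    rw [Nat.cast_zero, mul_zero, sub_zero] at this
    rw [this, hy0]
    exact (isUnit_iff_exists_inv.2 ⟨X d, by rw [mul_comm, ha]⟩).map _
  · by_cases hn : 0 < e * (n - 0)
    · rw [gcomp_apply_of_lt hX (fun n hn => ofSeq_of_lt (-d) y hn)
        (by rw [add_neg_cancel]; exact hn), Pi.single_eq_of_ne]
      rintro rfl
      simp at hn
    · obtain ⟨k, rfl⟩ := eq_sub_of_not_lt hn
      have := gcomp_apply_sub (s := s) hX (fun n hn => ofSeq_of_lt (e := e) (-d) y hn) k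
      rw [add_neg_cancel] at this
      rw [this]
      simp only [ofSeq_sub, heq]
      by_cases hk : k = 0
      · simp [hk]
      · rw [if_neg hk, Pi.single_eq_of_ne]
        simp [hk]

/-- An operator whose leading coefficient is a unit has an inverse. -/
theorem exists_inverse {X : ℤ → K} {d : ℤ} (hX : ∀ n, 0 < e * (n - d) → X n = 0)
    (hd : IsUnit (X d)) :
    ∃ Y : ℤ → K, (∀ n, 0 < e * (n - -d) → Y n = 0) ∧
      s.gcomp X Y = Pi.single 0 1 ∧ s.gcomp Y X = Pi.single 0 1 := by
  -- Y is a right inverse of X and Z one of Y; associativity forces X = Z, so Y is also a left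
  -- inverse.
  obtain ⟨Y, hY, hYd, hXY⟩ := exists_right_inverse (s := s) hX hd
  obtain ⟨Z, hZ, -, hYZ⟩ := exists_right_inverse (s := s) hY hYd
  refine ⟨Y, hY, hXY, ?_⟩
  let x : Ops s e := ⟨X, mem_boundedOps_of_lt hX⟩
  let y : Ops s e := ⟨Y, mem_boundedOps_of_lt hY⟩
  let z : Ops s e := ⟨Z, mem_boundedOps_of_lt hZ⟩
  have hxy : x * y = 1 := Subtype.ext hXY
  have hyz : y * z = 1 := Subtype.ext hYZ
  have hxz : x = z := by rw [← mul_one x, ← hyz, ← mul_assoc, hxy, one_mul]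
  have hyx : y * x = 1 := by rw [hxz, hyz]
  exact congrArg Ops.coeff hyx

end Bounded

section Sqrt

variable {K : Type*} [CommRing K] {s : ShiftAction K}

theorem sum_antidiagonal_eq_ends {M : Type*} [AddCommMonoid M] (f : ℕ × ℕ → M) (k : ℕ) :
    ∑ q ∈ Finset.HasAntidiagonal.antidiagonal (k + 1), f q = f (0, k + 1) + f (k + 1, 0)
      + ∑ q ∈ Finset.HasAntidiagonal.antidiagonal (k + 1), if q.1 < k + 1 ∧ q.2 < k + 1 then f q else 0 := by
  have h0 : ((0, k + 1) : ℕ × ℕ) ∈ Finset.HasAntidiagonal.antidiagonal (k + 1) := by simp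
  have h1 : ((k + 1, 0) : ℕ × ℕ) ∈ (Finset.HasAntidiagonal.antidiagonal (k + 1)).erase (0, k + 1) := by simp
  rw [← Finset.add_sum_erase _ _ h0, ← Finset.add_sum_erase _ _ h1,
    ← Finset.add_sum_erase _ (fun q : ℕ × ℕ => if q.1 < k + 1 ∧ q.2 < k + 1 then f q else 0) h0,
    ← Finset.add_sum_erase _ (fun q : ℕ × ℕ => if q.1 < k + 1 ∧ q.2 < k + 1 then f q else 0) h1]
  simp only [lt_irrefl, and_false, false_and, if_false, zero_add, add_assoc]
  congr 2
  refine Finset.sum_congr rfl fun q hq => ?_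
  rw [if_pos]
  simp only [Finset.mem_erase, Finset.HasAntidiagonal.mem_antidiagonal, ne_eq, Prod.ext_iff] at hq
  omega

/-- As the leading coefficient is 1, the two ends of the Cauchy product contribute c + Λc for the
newest coefficient c, and all other terms involve earlier ones. Extracting a root thus amounts to
inverting 1 + Λ at every step. -/
theorem gcomp_self_sub {R : ℤ → K} (hR : ∀ n, 1 < n → R n = 0) (h1 : R 1 = 1) (k : ℕ) :
    s.gcomp R R (2 - (k + 1 : ℕ)) = R (1 - (k + 1 : ℕ)) + s.σ 1 (R (1 - (k + 1 : ℕ)))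
      + ∑ q ∈ Finset.HasAntidiagonal.antidiagonal (k + 1), if q.1 < k + 1 ∧ q.2 < k + 1 then
        R (1 - q.1) * s.σ (1 - q.1) (R (1 - q.2)) else 0 := by
  have hR' : ∀ n, 0 < ((1 : ℤˣ) : ℤ) * (n - 1) → R n = 0 := fun n hn =>
    hR n (by simp at hn; omega)
  have := gcomp_apply_sub (s := s) hR' hR' (k + 1)
  simp only [Units.val_one, one_mul] at this
  rw [show (2 : ℤ) = 1 + 1 by norm_num, this, sum_antidiagonal_eq_ends]
  simp only [Nat.cast_zero, sub_zero, h1, one_mul, map_one, mul_one]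
  ring

theorem exists_sqrt (hs : Function.Surjective fun x => x + s.σ 1 x) {X : ℤ → K}
    (hX : ∀ n, 2 < n → X n = 0) (h2 : X 2 = 1) :
    ∃ R : ℤ → K, (∀ n, 1 < n → R n = 0) ∧ R 1 = 1 ∧ s.gcomp R R = X := by
  choose g hg using hs
  obtain ⟨y, hy⟩ := exists_strong_rec fun (n : ℕ) (z : ∀ m < n, K) =>
    if n = 0 then (1 : K) else
      g (X (2 - n) - ∑ q ∈ (Finset.HasAntidiagonal.antidiagonal n).attach,
        if h : q.1.1 < n ∧ q.1.2 < n then z q.1.1 h.1 * s.σ (1 - q.1.1) (z q.1.2 h.2) else 0)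
  have hsub : ∀ k : ℕ, ofSeq 1 1 y (1 - k) = y k := fun k => by
    simpa using ofSeq_sub (e := 1) 1 y k
  have hlt : ∀ n, 1 < n → ofSeq 1 1 y n = 0 := fun n hn =>
    ofSeq_of_lt _ _ (by simpa using hn)
  have h1 : ofSeq 1 1 y 1 = 1 := by
    have := hsub 0
    rw [Nat.cast_zero, sub_zero] at this
    rw [this, hy, if_pos rfl]
  refine ⟨ofSeq 1 1 y, hlt, h1, funext fun n => ?_⟩
  have hlt' : ∀ n, 0 < ((1 : ℤˣ) : ℤ) * (n - 1) → ofSeq 1 1 y n = 0 := fun n hn =>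
    ofSeq_of_lt _ _ hn
  rcases lt_trichotomy n 2 with hn | rfl | hn
  · obtain ⟨k, rfl⟩ : ∃ k : ℕ, n = 2 - (k + 1 : ℕ) := ⟨(1 - n).toNat, by push_cast; omega⟩
    rw [gcomp_self_sub hlt h1]
    simp only [hsub]
    have h := hg (X (2 - (k + 1 : ℕ)) - ∑ q ∈ Finset.HasAntidiagonal.antidiagonal (k + 1),
      if q.1 < k + 1 ∧ q.2 < k + 1 then y q.1 * s.σ (1 - q.1) (y q.2) else 0)
    have hyk := hy (k + 1)
    rw [if_neg (Nat.succ_ne_zero k), Finset.sum_attach (Finset.HasAntidiagonal.antidiagonal (k + 1))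
      (fun q : ℕ × ℕ => if _ : q.1 < k + 1 ∧ q.2 < k + 1 then
        y q.1 * s.σ (1 - q.1) (y q.2) else 0)] at hyk
    simp only [dite_eq_ite] at hyk
    rw [← hyk] at h
    simp only at h
    rw [h, sub_add_cancel]
  · have := gcomp_apply_sub (s := s) hlt' hlt' 0
    simpa [h1, h2] using this
  · rw [hX n hn, gcomp_apply_of_lt hlt' hlt' (by simpa using by linarith)]

theorem sqrt_unique (hs : Function.Injective fun x => x + s.σ 1 x) {R R' : ℤ → K}
    (hR : ∀ n, 1 < n → R n = 0) (hR1 : R 1 = 1) (hR' : ∀ n, 1 < n → R' n = 0) (hR1' : R' 1 = 1)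
    (h : s.gcomp R R = s.gcomp R' R') : R = R' := by
  have key : ∀ k : ℕ, R (1 - k) = R' (1 - k) := by
    intro k
    induction k using Nat.strong_induction_on with
    | _ k ih =>
      rcases k with _ | k
      · simp [hR1, hR1']
      · have h' := congrFun h (2 - (k + 1 : ℕ))
        rw [gcomp_self_sub hR hR1, gcomp_self_sub hR' hR1'] at h'
        have hsum : (∑ q ∈ Finset.HasAntidiagonal.antidiagonal (k + 1), if q.1 < k + 1 ∧ q.2 < k + 1 then
            R (1 - q.1) * s.σ (1 - q.1) (R (1 - q.2)) else 0)
            = ∑ q ∈ Finset.HasAntidiagonal.antidiagonal (k + 1), if q.1 < k + 1 ∧ q.2 < k + 1 then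
            R' (1 - q.1) * s.σ (1 - q.1) (R' (1 - q.2)) else 0 := by
          refine Finset.sum_congr rfl fun q _ => ?_
          split_ifs with hq
          · rw [ih _ hq.1, ih _ hq.2]
          · rfl
        rw [hsum] at h'
        exact hs (add_right_cancel h')
  funext n
  by_cases hn : 1 < n
  · rw [hR n hn, hR' n hn]
  · have := key (1 - n).toNat
    rwa [Int.toNat_of_nonneg (by omega), sub_sub_cancel] at this

end Sqrt

/-! ### Power series in `ε∂` for a derivation `∂` -/

/-- Both sides sum over 2×2 arrays with total N, grouped by rows or by columns. This reindexing
underlies the multiplicativity of the shifts. -/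
theorem sum_antidiagonal_quadruple {M : Type*} [AddCommMonoid M] (f : ℕ → ℕ → ℕ → ℕ → M) (N : ℕ) :
    ∑ p ∈ Finset.HasAntidiagonal.antidiagonal N,
      ∑ q ∈ Finset.HasAntidiagonal.antidiagonal p.1,
        ∑ r ∈ Finset.HasAntidiagonal.antidiagonal p.2, f q.1 q.2 r.1 r.2
    = ∑ p ∈ Finset.HasAntidiagonal.antidiagonal N,
      ∑ q ∈ Finset.HasAntidiagonal.antidiagonal p.1,
        ∑ r ∈ Finset.HasAntidiagonal.antidiagonal p.2, f q.1 r.1 q.2 r.2 := by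
  simp_rw [Finset.sum_sigma']
  refine Finset.sum_nbij'
    (fun x => ⟨(x.2.1.1 + x.2.2.1, x.2.1.2 + x.2.2.2), (x.2.1.1, x.2.2.1), (x.2.1.2, x.2.2.2)⟩)
    (fun x => ⟨(x.2.1.1 + x.2.2.1, x.2.1.2 + x.2.2.2), (x.2.1.1, x.2.2.1), (x.2.1.2, x.2.2.2)⟩)
    ?_ ?_ ?_ ?_ ?_
  · rintro ⟨⟨a, b⟩, ⟨a1, a2⟩, ⟨b1, b2⟩⟩ h
    simp only [Finset.mem_sigma, Finset.HasAntidiagonal.mem_antidiagonal, and_self, and_true] at h ⊢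
    omega
  · rintro ⟨⟨a, b⟩, ⟨a1, a2⟩, ⟨b1, b2⟩⟩ h
    simp only [Finset.mem_sigma, Finset.HasAntidiagonal.mem_antidiagonal, and_self, and_true] at h ⊢
    omega
  · rintro ⟨⟨a, b⟩, ⟨a1, a2⟩, ⟨b1, b2⟩⟩ h
    simp only [Finset.mem_sigma, Finset.HasAntidiagonal.mem_antidiagonal] at h ⊢
    obtain ⟨h1, rfl, rfl⟩ := h
    rfl
  · rintro ⟨⟨a, b⟩, ⟨a1, a2⟩, ⟨b1, b2⟩⟩ h
    simp only [Finset.mem_sigma, Finset.HasAntidiagonal.mem_antidiagonal] at h ⊢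
    obtain ⟨h1, rfl, rfl⟩ := h
    rfl
  · rintro ⟨⟨a, b⟩, ⟨a1, a2⟩, ⟨b1, b2⟩⟩ h
    rfl

theorem sum_antidiagonal_triple {M : Type*} [AddCommMonoid M] (f : ℕ → ℕ → ℕ → M) (N : ℕ) :
    ∑ p ∈ Finset.HasAntidiagonal.antidiagonal N,
      ∑ q ∈ Finset.HasAntidiagonal.antidiagonal p.1, f q.1 q.2 p.2
    = ∑ p ∈ Finset.HasAntidiagonal.antidiagonal N,
      ∑ q ∈ Finset.HasAntidiagonal.antidiagonal p.2, f p.1 q.1 q.2 := by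
  simp_rw [Finset.sum_sigma']
  refine Finset.sum_nbij'
    (fun x => ⟨(x.2.1, x.2.2 + x.1.2), (x.2.2, x.1.2)⟩)
    (fun x => ⟨(x.1.1 + x.2.1, x.2.2), (x.1.1, x.2.1)⟩)
    ?_ ?_ ?_ ?_ ?_
  · rintro ⟨⟨a, b⟩, ⟨c, d⟩⟩ h
    simp only [Finset.mem_sigma, Finset.HasAntidiagonal.mem_antidiagonal, and_true] at h ⊢
    omega
  · rintro ⟨⟨a, b⟩, ⟨c, d⟩⟩ h
    simp only [Finset.mem_sigma, Finset.HasAntidiagonal.mem_antidiagonal, and_true] at h ⊢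
    omega
  · rintro ⟨⟨a, b⟩, ⟨c, d⟩⟩ h
    simp only [Finset.mem_sigma, Finset.HasAntidiagonal.mem_antidiagonal] at h ⊢
    obtain ⟨h1, rfl⟩ := h
    rfl
  · rintro ⟨⟨a, b⟩, ⟨c, d⟩⟩ h
    simp only [Finset.mem_sigma, Finset.HasAntidiagonal.mem_antidiagonal] at h ⊢
    obtain ⟨h1, rfl⟩ := h
    rfl
  · rintro ⟨⟨a, b⟩, ⟨c, d⟩⟩ h
    rfl

section Symbols

variable {K : Type*} [CommRing K] [Algebra ℝ K]

/-- The operator `φ(ε∂) = ∑_n φ_n ε^n ∂^n` on `K[[ε]]`. -/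
def symOp (D : K →ₗ[ℝ] K) (φ : PowerSeries ℝ) : Module.End ℝ (PowerSeries K) where
  toFun f := PowerSeries.mk fun N =>
    ∑ q ∈ Finset.HasAntidiagonal.antidiagonal N,
      PowerSeries.coeff q.1 φ • (D ^ q.1) (PowerSeries.coeff q.2 f)
  map_add' f g := by
    ext1 N
    simp [smul_add, Finset.sum_add_distrib]
  map_smul' c f := by
    ext1 N
    simp [Finset.smul_sum, smul_comm c]

theorem coeff_symOp (D : K →ₗ[ℝ] K) (φ : PowerSeries ℝ) (f : PowerSeries K) (N : ℕ) :
    PowerSeries.coeff N (symOp D φ f) = ∑ q ∈ Finset.HasAntidiagonal.antidiagonal N,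
      PowerSeries.coeff q.1 φ • (D ^ q.1) (PowerSeries.coeff q.2 f) := by
  simp only [symOp, LinearMap.coe_mk, AddHom.coe_mk, PowerSeries.coeff_mk]

theorem coeff_zero_symOp (D : K →ₗ[ℝ] K) (φ : PowerSeries ℝ) (f : PowerSeries K) :
    PowerSeries.coeff 0 (symOp D φ f) = PowerSeries.coeff 0 φ • PowerSeries.coeff 0 f := by
  rw [coeff_symOp]
  simp only [Finset.HasAntidiagonal.antidiagonal_zero, Finset.sum_singleton, pow_zero, Module.End.one_apply]

theorem symOp_add (D : K →ₗ[ℝ] K) (φ ψ : PowerSeries ℝ) :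
    symOp D (φ + ψ) = symOp D φ + symOp D ψ := by
  refine LinearMap.ext fun f => PowerSeries.ext fun N => ?_
  rw [LinearMap.add_apply, map_add, coeff_symOp, coeff_symOp, coeff_symOp, ← Finset.sum_add_distrib]
  simp only [map_add, add_smul]

theorem symOp_neg (D : K →ₗ[ℝ] K) (φ : PowerSeries ℝ) : symOp D (-φ) = -symOp D φ := by
  refine LinearMap.ext fun f => PowerSeries.ext fun N => ?_
  rw [LinearMap.neg_apply, map_neg, coeff_symOp, coeff_symOp, ← Finset.sum_neg_distrib]
  simp only [map_neg, neg_smul]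

theorem symOp_sub (D : K →ₗ[ℝ] K) (φ ψ : PowerSeries ℝ) :
    symOp D (φ - ψ) = symOp D φ - symOp D ψ := by
  rw [sub_eq_add_neg, symOp_add, symOp_neg, sub_eq_add_neg]

theorem symOp_mul (D : K →ₗ[ℝ] K) (φ ψ : PowerSeries ℝ) :
    symOp D (φ * ψ) = symOp D φ * symOp D ψ := by
  refine LinearMap.ext fun f => PowerSeries.ext fun N => ?_
  rw [Module.End.mul_apply, coeff_symOp, coeff_symOp]
  have h := sum_antidiagonal_triple (fun a b c => (PowerSeries.coeff a φ * PowerSeries.coeff b ψ) •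
    (D ^ (a + b)) (PowerSeries.coeff c f)) N
  refine Eq.trans (Finset.sum_congr rfl fun p _ => ?_) (h.trans (Finset.sum_congr rfl fun p _ => ?_))
  · rw [PowerSeries.coeff_mul, Finset.sum_smul]
    refine Finset.sum_congr rfl fun q hq => ?_
    rw [Finset.HasAntidiagonal.mem_antidiagonal.1 hq]
  · rw [coeff_symOp, map_sum, Finset.smul_sum]
    refine Finset.sum_congr rfl fun q _ => ?_
    rw [map_smul, pow_add, Module.End.mul_apply, mul_smul]

theorem symOp_of_deriv_eq_zero (D : K →ₗ[ℝ] K) (φ : PowerSeries ℝ) {a : K} (ha : D a = 0) :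
    symOp D φ (PowerSeries.C a) = PowerSeries.coeff 0 φ • PowerSeries.C a := by
  refine PowerSeries.ext fun N => ?_
  rw [coeff_symOp, PowerSeries.coeff_smul,
    ← Finset.add_sum_erase _ _ (show ((0, N) : ℕ × ℕ) ∈ Finset.HasAntidiagonal.antidiagonal N by simp),
    Finset.sum_eq_zero, add_zero]
  · simp
  · rintro ⟨p, q⟩ hpq
    simp only [Finset.mem_erase, Finset.HasAntidiagonal.mem_antidiagonal, ne_eq, Prod.ext_iff] at hpq
    obtain ⟨p, rfl⟩ : ∃ r, p = r + 1 := ⟨p - 1, by omega⟩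
    have h : D (PowerSeries.coeff q (PowerSeries.C a)) = 0 := by
      rw [PowerSeries.coeff_C]
      split_ifs <;> simp [ha]
    simp only [pow_succ, Module.End.mul_apply, h, map_zero, smul_zero]

theorem symOp_one (D : K →ₗ[ℝ] K) : symOp D 1 = 1 := by
  refine LinearMap.ext fun f => PowerSeries.ext fun N => ?_
  rw [coeff_symOp, Module.End.one_apply, Finset.sum_eq_single (0, N)]
  · simp
  · rintro ⟨p, q⟩ hpq h
    have : p ≠ 0 := by
      rintro rfl
      simp at hpq
      exact h (by rw [hpq])
    simp [PowerSeries.coeff_one, this]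
  · intro h
    simp at h

theorem map_symOp {K' : Type*} [CommRing K'] [Algebra ℝ K'] (D : K →ₗ[ℝ] K) (D' : K' →ₗ[ℝ] K')
    (f : K →ₐ[ℝ] K') (hf : ∀ x, f (D x) = D' (f x)) (φ : PowerSeries ℝ) (x : PowerSeries K) :
    PowerSeries.map (f : K →+* K') (symOp D φ x)
      = symOp D' φ (PowerSeries.map (f : K →+* K') x) := by
  have hp : ∀ (n : ℕ) (x : K), f ((D ^ n) x) = (D' ^ n) (f x) := by
    intro n
    induction n with
    | zero => intro x; simp
    | succ n ih => intro x; rw [pow_succ', pow_succ', Module.End.mul_apply, Module.End.mul_apply, hf, ih]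
  refine PowerSeries.ext fun N => ?_
  rw [PowerSeries.coeff_map, coeff_symOp, coeff_symOp, map_sum]
  refine Finset.sum_congr rfl fun q _ => ?_
  rw [PowerSeries.coeff_map, RingHom.coe_coe, map_smul, hp]

theorem Derivation.pow_apply_mul (D : Derivation ℝ K K) (n : ℕ) (f g : K) :
    ((D : K →ₗ[ℝ] K) ^ n) (f * g) = ∑ q ∈ Finset.HasAntidiagonal.antidiagonal n,
      (n.choose q.1 : K) * (((D : K →ₗ[ℝ] K) ^ q.1) f * ((D : K →ₗ[ℝ] K) ^ q.2) g) := by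
  induction n with
  | zero => simp
  | succ n ih =>
    rw [Finset.sum_antidiagonal_choose_succ_mul
      (fun a b => ((D : K →ₗ[ℝ] K) ^ a) f * ((D : K →ₗ[ℝ] K) ^ b) g), pow_succ', Module.End.mul_apply,
      ih, map_sum, ← Finset.sum_add_distrib]
    refine Finset.sum_congr rfl fun q hq => ?_
    have hc : n.choose q.2 = n.choose q.1 :=
      Nat.choose_symm_of_eq_add (by have := Finset.HasAntidiagonal.mem_antidiagonal.1 hq; omega)
    rw [hc, pow_succ', pow_succ', Module.End.mul_apply, Module.End.mul_apply]
    simp only [Derivation.coeFn_coe, Derivation.leibniz, smul_eq_mul, Derivation.map_natCast]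
    ring

theorem coeff_expSymbol (j : ℤ) (n : ℕ) :
    PowerSeries.coeff n (expSymbol j) = (j : ℝ) ^ n / n.factorial := by
  simp [expSymbol, PowerSeries.coeff_rescale, PowerSeries.coeff_exp, div_eq_mul_inv]

theorem expSymbol_add (i j : ℤ) : expSymbol (i + j) = expSymbol i * expSymbol j := by
  unfold expSymbol
  rw [PowerSeries.exp_mul_exp_eq_exp_add, Int.cast_add]

theorem expSymbol_zero : expSymbol 0 = 1 := by
  refine PowerSeries.ext fun n => ?_
  rw [coeff_expSymbol, PowerSeries.coeff_one]
  rcases n with _ | n <;> simp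

/-- The exponential of a derivation is multiplicative: the coefficients c_n = j^n/n! satisfy
c_{a+b}·binom(a+b, a) = c_a c_b, which absorbs the binomials of the Leibniz rule. -/
theorem symOp_expSymbol_mul (D : Derivation ℝ K K) (j : ℤ) (f g : PowerSeries K) :
    symOp (D : K →ₗ[ℝ] K) (expSymbol j) (f * g)
      = symOp (D : K →ₗ[ℝ] K) (expSymbol j) f * symOp (D : K →ₗ[ℝ] K) (expSymbol j) g := by
  refine PowerSeries.ext fun N => ?_
  set c : ℕ → ℝ := fun n => PowerSeries.coeff n (expSymbol j) with hc
  have hchoose : ∀ a b : ℕ, c (a + b) * ((a + b).choose a : ℝ) = c a * c b := fun a b => by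
    simp only [hc, coeff_expSymbol]
    have h : ((a + b).choose a : ℝ) * a.factorial * b.factorial = (a + b).factorial := by
      rw [Nat.choose_symm_add]
      exact_mod_cast Nat.add_choose_mul_factorial_mul_factorial a b
    have ha : (a.factorial : ℝ) ≠ 0 := by exact_mod_cast a.factorial_ne_zero
    have hb : (b.factorial : ℝ) ≠ 0 := by exact_mod_cast b.factorial_ne_zero
    have hab : ((a + b).factorial : ℝ) ≠ 0 := by exact_mod_cast (a + b).factorial_ne_zero
    field_simp
    rw [← h, pow_add]
    ring
  have h := sum_antidiagonal_quadruple (fun a b x y => (c a * c b) •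
    (((D : K →ₗ[ℝ] K) ^ a) (PowerSeries.coeff x f) * ((D : K →ₗ[ℝ] K) ^ b) (PowerSeries.coeff y g))) N
  rw [coeff_symOp, PowerSeries.coeff_mul]
  refine Eq.trans (Finset.sum_congr rfl fun p _ => ?_) (h.trans (Finset.sum_congr rfl fun p _ => ?_))
  · rw [PowerSeries.coeff_mul, map_sum, Finset.smul_sum, Finset.sum_comm]
    refine Finset.sum_congr rfl fun r _ => ?_
    rw [Derivation.pow_apply_mul, Finset.smul_sum]
    refine Finset.sum_congr rfl fun q hq => ?_
    rw [← hchoose, ← Finset.HasAntidiagonal.mem_antidiagonal.1 hq, mul_smul, ← nsmul_eq_mul,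
      Nat.cast_smul_eq_nsmul]
  · rw [coeff_symOp, coeff_symOp, Finset.sum_mul_sum]
    refine Finset.sum_congr rfl fun q _ => Finset.sum_congr rfl fun r _ => ?_
    rw [smul_mul_smul_comm]

/-- The shifts `e^{jε∂}` on `K[[ε]]`. -/
def shiftAction (D : Derivation ℝ K K) : ShiftAction (PowerSeries K) where
  σ j :=
    { toFun := symOp (D : K →ₗ[ℝ] K) (expSymbol j)
      map_one' := by
        rw [← map_one PowerSeries.C, symOp_of_deriv_eq_zero _ _ (by simp), coeff_expSymbol]
        simp
      map_mul' := symOp_expSymbol_mul D j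
      map_zero' := map_zero _
      map_add' := map_add _ }
  zero_apply x := by
    change symOp (D : K →ₗ[ℝ] K) (expSymbol 0) x = x
    rw [expSymbol_zero, symOp_one, Module.End.one_apply]
  add_apply i j x := by
    change symOp (D : K →ₗ[ℝ] K) (expSymbol (i + j)) x = _
    rw [expSymbol_add, symOp_mul]
    rfl

theorem shiftAction_apply (D : Derivation ℝ K K) (j : ℤ) (f : PowerSeries K) :
    (shiftAction D).σ j f = symOp (D : K →ₗ[ℝ] K) (expSymbol j) f := rfl

theorem one_add_expSymbol_mul_inv (j : ℤ) : (1 + expSymbol j) * (1 + expSymbol j)⁻¹ = 1 :=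
  PowerSeries.mul_inv_cancel _ (by
    rw [← PowerSeries.coeff_zero_eq_constantCoeff_apply, map_add, coeff_expSymbol]
    norm_num)

/-- The symbol 1 + e^z has constant term 2, hence an inverse power series, which gives the inverse
operator. This is what makes square roots exist and be unique. -/
theorem one_add_shift_bijective (D : Derivation ℝ K K) :
    Function.Bijective fun x => x + (shiftAction D).σ 1 x := by
  have h : ∀ x, x + (shiftAction D).σ 1 x = symOp (D : K →ₗ[ℝ] K) (1 + expSymbol 1) x := fun x => by
    rw [symOp_add, symOp_one]
    rfl
  simp only [h]
  refine Function.bijective_iff_has_inverse.2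
    ⟨symOp (D : K →ₗ[ℝ] K) (1 + expSymbol 1)⁻¹, fun x => ?_, fun x => ?_⟩
  · rw [← Module.End.mul_apply, ← symOp_mul, mul_comm, one_add_expSymbol_mul_inv, symOp_one,
      Module.End.one_apply]
  · change symOp (D : K →ₗ[ℝ] K) (1 + expSymbol 1) (symOp (D : K →ₗ[ℝ] K) (1 + expSymbol 1)⁻¹ x) = x
    rw [← Module.End.mul_apply, ← symOp_mul, one_add_expSymbol_mul_inv, symOp_one,
      Module.End.one_apply]

end Symbols

/-! ### Variations -/

/-- A ring with a derivation `∂` and the derivations `∂/∂q_s` with respect to the jets `q_s = ∂^s q`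
of one unknown function `q`. -/
structure JetSystem (R : Type*) [CommRing R] [Algebra ℝ R] where
  /-- The total derivative. -/
  D : Derivation ℝ R R
  /-- The derivative with respect to the jet of order `s`. -/
  p : ℕ → Derivation ℝ R R
  finite_support : ∀ f, (Function.support fun s => p s f).Finite
  comm_zero : ∀ f, p 0 (D f) = D (p 0 f)
  comm_succ : ∀ s f, p (s + 1) (D f) = D (p (s + 1) f) + p s f

/-- The ring `R` extended by the square-zero ideal of the variations `∑_s f_s δq_s`. -/
abbrev VarRing (R : Type*) [CommRing R] : Type _ := TrivSqZeroExt R (ℕ →₀ R)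

namespace JetSystem

variable {R : Type*} [CommRing R] [Algebra ℝ R] (J : JetSystem R)

/-- The total derivative of a variation: `∂(f δq_s) = (∂f) δq_s + f δq_{s+1}`. -/
def formD : (ℕ →₀ R) →ₗ[ℝ] (ℕ →₀ R) :=
  Finsupp.mapRange.linearMap (J.D : R →ₗ[ℝ] R) + Finsupp.lmapDomain R ℝ Nat.succ

theorem formD_single (s : ℕ) (f : R) :
    J.formD (Finsupp.single s f) = Finsupp.single s (J.D f) + Finsupp.single (s + 1) f := by
  simp [formD, Finsupp.mapDomain_single]

theorem formD_apply_zero (θ : ℕ →₀ R) : J.formD θ 0 = J.D (θ 0) := by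
  simp only [formD, LinearMap.add_apply, Finsupp.add_apply, Finsupp.mapRange.linearMap_apply,
    Finsupp.mapRange_apply, Finsupp.lmapDomain_apply]
  rw [Finsupp.mapDomain_of_notMem_range _ _ (by simp)]
  simp

theorem formD_apply_succ (θ : ℕ →₀ R) (s : ℕ) : J.formD θ (s + 1) = J.D (θ (s + 1)) + θ s := by
  simp only [formD, LinearMap.add_apply, Finsupp.add_apply, Finsupp.mapRange.linearMap_apply,
    Finsupp.mapRange_apply, Finsupp.lmapDomain_apply]
  rw [show s + 1 = Nat.succ s from rfl, Finsupp.mapDomain_apply Nat.succ_injective]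
  rfl

theorem formD_smul (f : R) (θ : ℕ →₀ R) : J.formD (f • θ) = J.D f • θ + f • J.formD θ := by
  ext s
  rcases s with _ | s
  · simp only [formD_apply_zero, Finsupp.add_apply, Finsupp.smul_apply, smul_eq_mul,
      Derivation.leibniz]
    ring
  · simp only [formD_apply_succ, Finsupp.add_apply, Finsupp.smul_apply, smul_eq_mul,
      Derivation.leibniz]
    ring

/-- The total derivative on the ring with variations. -/
def varD : Derivation ℝ (VarRing R) (VarRing R) :=
  Derivation.mk'
    { toFun := fun x => (TrivSqZeroExt.inl (J.D x.fst) + TrivSqZeroExt.inr (J.formD x.snd))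
      map_add' := fun x y => by
        refine TrivSqZeroExt.ext ?_ ?_ <;> simp
      map_smul' := fun c x => by
        refine TrivSqZeroExt.ext ?_ ?_ <;> simp }
    fun x y => by
      refine TrivSqZeroExt.ext ?_ ?_
      · simp [TrivSqZeroExt.fst_mul]
      · simp [TrivSqZeroExt.snd_mul, formD_smul]
        abel

theorem fst_varD (x : VarRing R) : (J.varD x).fst = J.D x.fst := by
  simp [varD]

theorem snd_varD (x : VarRing R) : (J.varD x).snd = J.formD x.snd := by
  simp [varD]

/-- The Euler operator `∑_s f_s δq_s ↦ ∑_s (-∂)^s f_s`. -/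
def euler : (ℕ →₀ R) →ₗ[ℝ] R := Finsupp.lsum ℝ fun s => (-(J.D : R →ₗ[ℝ] R)) ^ s

theorem euler_single (s : ℕ) (f : R) :
    J.euler (Finsupp.single s f) = ((-(J.D : R →ₗ[ℝ] R)) ^ s) f := by
  simp [euler]

/-- Integration by parts: (-∂)^s(∂f) and (-∂)^{s+1}f cancel. -/
theorem euler_formD (θ : ℕ →₀ R) : J.euler (J.formD θ) = 0 := by
  induction θ using Finsupp.induction_linear with
  | zero => simp
  | add f g hf hg => rw [map_add, map_add, hf, hg, add_zero]
  | single s f =>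
    rw [formD_single, map_add, euler_single, euler_single, pow_succ, Module.End.mul_apply]
    simp

/-- The differential `f ↦ ∑_s (∂f/∂q_s) δq_s`. -/
def diff (f : R) : ℕ →₀ R := Finsupp.ofSupportFinite (fun s => J.p s f) (J.finite_support f)

theorem diff_apply (f : R) (s : ℕ) : J.diff f s = J.p s f := rfl

/-- The map `f ↦ f + δf`. -/
def perturb : R →ₐ[ℝ] VarRing R :=
  AlgHom.ofLinearMap
    { toFun := fun f => (TrivSqZeroExt.inl f + TrivSqZeroExt.inr (J.diff f))
      map_add' := fun f g => by
        refine TrivSqZeroExt.ext (by simp) (Finsupp.ext fun s => ?_)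
        simp [diff_apply]
      map_smul' := fun c f => by
        refine TrivSqZeroExt.ext (by simp) (Finsupp.ext fun s => ?_)
        simp [diff_apply] }
    (by
      refine TrivSqZeroExt.ext (by simp) (Finsupp.ext fun s => ?_)
      simp [diff_apply])
    (fun f g => by
      refine TrivSqZeroExt.ext (by simp) (Finsupp.ext fun s => ?_)
      simp [diff_apply, TrivSqZeroExt.snd_mul])

theorem perturb_apply (f : R) :
    J.perturb f = TrivSqZeroExt.inl f + TrivSqZeroExt.inr (J.diff f) := rfl

/-- This is where the rules `comm_zero` and `comm_succ` enter. It makes the perturbation commute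
with every power series in ε∂, and so extend to a homomorphism of difference operators. -/
theorem perturb_D (f : R) : J.perturb (J.D f) = J.varD (J.perturb f) := by
  refine TrivSqZeroExt.ext (by simp [fst_varD, perturb_apply]) (Finsupp.ext fun s => ?_)
  rw [snd_varD, perturb_apply, perturb_apply]
  rcases s with _ | s
  · simp [diff_apply, formD_apply_zero, J.comm_zero]
  · simp [diff_apply, formD_apply_succ, J.comm_succ]

theorem inl_D (f : R) : TrivSqZeroExt.inlAlgHom ℝ R (ℕ →₀ R) (J.D f)
    = J.varD (TrivSqZeroExt.inlAlgHom ℝ R (ℕ →₀ R) f) := by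
  refine TrivSqZeroExt.ext (by simp [fst_varD]) (by simp [snd_varD])

/-- The variational derivative `∑_s (-∂)^s ∂/∂q_s`. -/
theorem euler_diff (f : R) :
    J.euler (J.diff f) = ∑ᶠ s, ((-(J.D : R →ₗ[ℝ] R)) ^ s) (J.p s f) := by
  rw [euler, Finsupp.lsum_apply, Finsupp.sum, finsum_eq_sum_of_support_subset]
  · rfl
  · intro s hs
    simp only [Finset.mem_coe, Finsupp.mem_support_iff]
    intro h
    apply hs
    change ((-(J.D : R →ₗ[ℝ] R)) ^ s) (J.p s f) = 0
    rw [← diff_apply, h, map_zero]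

/-! #### The same with power series in `ε` -/

/-- The inclusion of `R[[ε]]`. -/
def incl : PowerSeries R →+* PowerSeries (VarRing R) :=
  PowerSeries.map (TrivSqZeroExt.inlAlgHom ℝ R (ℕ →₀ R) : R →+* VarRing R)

/-- The map `f ↦ f + δf` on `R[[ε]]`. -/
def perturbEps : PowerSeries R →+* PowerSeries (VarRing R) :=
  PowerSeries.map (J.perturb : R →+* VarRing R)

/-- The functional that integrates a variation by parts to the form `g δq` and returns `g`. -/
def varTrace : PowerSeries (VarRing R) →+ PowerSeries R where
  toFun x := PowerSeries.mk fun N => J.euler (PowerSeries.coeff N x).snd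
  map_zero' := by ext N; simp
  map_add' x y := by ext N; simp

theorem coeff_varTrace (x : PowerSeries (VarRing R)) (N : ℕ) :
    PowerSeries.coeff N (J.varTrace x) = J.euler (PowerSeries.coeff N x).snd := by
  simp only [varTrace, AddMonoidHom.coe_mk, ZeroHom.coe_mk, PowerSeries.coeff_mk]

theorem incl_shift (i : ℤ) (x : PowerSeries R) :
    incl ((shiftAction J.D).σ i x) = (shiftAction J.varD).σ i (incl x) :=
  map_symOp _ _ _ J.inl_D _ _

theorem perturbEps_shift (i : ℤ) (x : PowerSeries R) :
    J.perturbEps ((shiftAction J.D).σ i x) = (shiftAction J.varD).σ i (J.perturbEps x) :=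
  map_symOp _ _ _ J.perturb_D _ _

/-- All terms of e^{iε∂} beyond the first are total derivatives, which the Euler operator
annihilates. This invariance makes the residue followed by `varTrace` a trace. -/
theorem varTrace_shift (i : ℤ) (x : PowerSeries (VarRing R)) :
    J.varTrace ((shiftAction J.varD).σ i x) = J.varTrace x := by
  refine PowerSeries.ext fun N => ?_
  rw [coeff_varTrace, coeff_varTrace, shiftAction_apply, coeff_symOp,
    ← Finset.add_sum_erase _ _ (show ((0, N) : ℕ × ℕ) ∈ Finset.HasAntidiagonal.antidiagonal N by simp),
    TrivSqZeroExt.snd_add, map_add, TrivSqZeroExt.snd_sum, map_sum, Finset.sum_eq_zero, add_zero]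
  · simp [coeff_expSymbol]
  · rintro ⟨a, b⟩ hab
    simp only [Finset.mem_erase, Finset.HasAntidiagonal.mem_antidiagonal, ne_eq, Prod.ext_iff] at hab
    obtain ⟨a, rfl⟩ : ∃ r, a = r + 1 := ⟨a - 1, by omega⟩
    rw [TrivSqZeroExt.snd_smul, map_smul, pow_succ', Module.End.mul_apply, Derivation.coeFn_coe,
      snd_varD, euler_formD, smul_zero]

theorem varTrace_incl (x : PowerSeries R) : J.varTrace (incl x) = 0 := by
  refine PowerSeries.ext fun N => ?_
  simp [coeff_varTrace, incl, PowerSeries.coeff_map]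

theorem varTrace_perturbEps (x : PowerSeries R) (N : ℕ) :
    PowerSeries.coeff N (J.varTrace (J.perturbEps x))
      = ∑ᶠ s, ((-(J.D : R →ₗ[ℝ] R)) ^ s) (J.p s (PowerSeries.coeff N x)) := by
  rw [coeff_varTrace, perturbEps, PowerSeries.coeff_map, ← euler_diff, RingHom.coe_coe,
    perturb_apply]
  simp

theorem varTrace_perturbEps_smul (c : ℝ) (x : PowerSeries R) :
    J.varTrace (J.perturbEps (c • x)) = c • J.varTrace (J.perturbEps x) := by
  refine PowerSeries.ext fun N => ?_
  rw [PowerSeries.coeff_smul, coeff_varTrace, coeff_varTrace, perturbEps, PowerSeries.coeff_map,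
    PowerSeries.coeff_map, PowerSeries.coeff_smul, RingHom.coe_coe, map_smul,
    TrivSqZeroExt.snd_smul, map_smul]

/-- The variation `δq`. -/
def delta : PowerSeries (VarRing R) := PowerSeries.C (TrivSqZeroExt.inr (Finsupp.single 0 1))

theorem varTrace_incl_mul_delta (g : PowerSeries R) : J.varTrace (incl g * delta) = g := by
  refine PowerSeries.ext fun N => ?_
  rw [coeff_varTrace, delta, PowerSeries.coeff_mul_C, incl, PowerSeries.coeff_map]
  simp [TrivSqZeroExt.snd_mul, euler_single]

theorem varTrace_incl_mul_shift_delta (g : PowerSeries R) (i : ℤ) :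
    J.varTrace (incl g * (shiftAction J.varD).σ i delta) = (shiftAction J.D).σ (-i) g := by
  rw [← J.varTrace_shift (-i), map_mul, ← incl_shift, ShiftAction.neg_apply_apply,
    varTrace_incl_mul_delta]

theorem sub_mul_sub_eq_zero (x y : PowerSeries R) :
    (J.perturbEps x - incl x) * (J.perturbEps y - incl y) = 0 := by
  refine PowerSeries.ext fun N => ?_
  rw [PowerSeries.coeff_mul]
  refine Finset.sum_eq_zero fun q _ => ?_
  simp only [map_sub, perturbEps, incl, PowerSeries.coeff_map, RingHom.coe_coe, perturb_apply,
    TrivSqZeroExt.inlAlgHom_apply, add_sub_cancel_left, TrivSqZeroExt.inr_mul_inr]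

attribute [irreducible] incl perturbEps varTrace delta

end JetSystem

/-! ### The jets of the unknown functions -/

theorem ext0_mul (f g : Smooth) : ext0 (f * g : Smooth) = ext0 f * ext0 g := by
  funext p
  by_cases hp : p ∈ U
  · lift p to U using hp
    simp [ext0_coe]
  · have h : ∀ f : U → ℝ, ext0 f p = 0 := fun f =>
      Function.extend_apply' _ _ _ (by rintro ⟨q, rfl⟩; exact hp q.2)
    simp [h]

theorem basePartial_apply (α : Fin 3) (f : Smooth) (p : U) :
    basePartial α f p = fderiv ℝ (ext0 f) p (Pi.single α 1) := rfl

theorem basePartial_mul (α : Fin 3) (f g : Smooth) :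
    basePartial α (f * g) = f * basePartial α g + g * basePartial α f := by
  ext p
  have hf := (contDiffAt_ext0 f p).differentiableAt (by simp)
  have hg := (contDiffAt_ext0 g p).differentiableAt (by simp)
  have h : (f * basePartial α g + g * basePartial α f) p
      = f p * basePartial α g p + g p * basePartial α f p := rfl
  rw [h, basePartial_apply, basePartial_apply, basePartial_apply, ext0_mul, fderiv_mul hf hg]
  simp [ext0_coe]

theorem eventuallyEq_ext0 {g : Vals → ℝ} {f : Smooth} (h : ∀ p : U, f p = g p) (p : U) :
    ext0 f =ᶠ[nhds (p : Vals)] g := by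
  filter_upwards [U.isOpen.mem_nhds p.2] with q hq
  exact (ext0_coe f ⟨q, hq⟩).trans (h ⟨q, hq⟩)

/-- U is open, so only the germ at p matters, and the extension by zero may be replaced by any
formula valid on U. -/
theorem basePartial_eq_of_eq {g : Vals → ℝ} {f : Smooth} (h : ∀ p : U, f p = g p) (α : Fin 3)
    (p : U) : basePartial α f p = fderiv ℝ g p (Pi.single α 1) := by
  rw [basePartial_apply, (eventuallyEq_ext0 h p).fderiv_eq]

theorem basePartial_comm (α β : Fin 3) (f : Smooth) :
    basePartial α (basePartial β f) = basePartial β (basePartial α f) := by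
  have key : ∀ (α β : Fin 3) (p : U), basePartial α (basePartial β f) p
      = fderiv ℝ (fderiv ℝ (ext0 f)) p (Pi.single α 1) (Pi.single β 1) := by
    intro α β p
    rw [basePartial_eq_of_eq (g := fun q => fderiv ℝ (ext0 f) q (Pi.single β 1)) (fun q => rfl)]
    have h : DifferentiableAt ℝ (fderiv ℝ (ext0 f)) p :=
      ((contDiffAt_ext0 f p).fderiv_right (m := ∞) le_rfl).differentiableAt (by simp)
    rw [fderiv_clm_apply h (differentiableAt_const _)]
    simp
  ext p
  rw [key, key]
  exact ((contDiffAt_ext0 f p).isSymmSndFDerivAt (by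
    rw [minSmoothness_of_isRCLikeNormedField]
    exact WithTop.coe_le_coe.2 (le_top : (2 : ℕ∞) ≤ ⊤))).eq _ _

theorem coeffPartial_monomial (α : Fin 3) (m : Fin 3 × ℕ →₀ ℕ) (a : Smooth) :
    coeffPartial α (MvPolynomial.monomial m a) = MvPolynomial.monomial m (basePartial α a) := by
  classical
  change ∑ n ∈ (MvPolynomial.monomial m a).support,
    MvPolynomial.monomial n (basePartial α ((MvPolynomial.monomial m a).coeff n)) = _
  rw [MvPolynomial.support_monomial]
  split_ifs with h
  · simp [h]
  · simp

theorem coeffPartial_mul (α : Fin 3) (f g : DiffPoly) :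
    coeffPartial α (f * g) = f * coeffPartial α g + g * coeffPartial α f := by
  induction f using MvPolynomial.induction_on' with
  | add f₁ f₂ h₁ h₂ =>
    rw [add_mul, map_add, h₁, h₂, map_add]
    ring
  | monomial m a =>
    induction g using MvPolynomial.induction_on' with
    | add g₁ g₂ h₁ h₂ =>
      rw [mul_add, map_add, h₁, h₂, map_add]
      ring
    | monomial n b =>
      rw [MvPolynomial.monomial_mul, coeffPartial_monomial, coeffPartial_monomial,
        coeffPartial_monomial, MvPolynomial.monomial_mul, MvPolynomial.monomial_mul,
        basePartial_mul, add_comm n m, map_add]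

/-- `∂/∂u^{α,0}` as a derivation. -/
def coeffDer (α : Fin 3) : Derivation ℝ DiffPoly DiffPoly :=
  Derivation.mk' (coeffPartial α) (coeffPartial_mul α)

/-- `∂/∂u^{α,s}` as a derivation. -/
def jetDer (α : Fin 3) : ℕ → Derivation ℝ DiffPoly DiffPoly
  | 0 => coeffDer α
  | s + 1 => (MvPolynomial.pderiv (R := Smooth) (α, s)).restrictScalars ℝ

theorem jetDer_apply (α : Fin 3) (s : ℕ) (f : DiffPoly) : jetDer α s f = jetPartial α s f := by
  rcases s with _ | s <;> rfl

/-- `∂_x` as a derivation. -/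
def dxDer : Derivation ℝ DiffPoly DiffPoly :=
  (∑ α : Fin 3, (MvPolynomial.X (α, 0) : DiffPoly) • coeffDer α) +
    (MvPolynomial.mkDerivation Smooth
      (fun j : Fin 3 × ℕ => (MvPolynomial.X (j.1, j.2 + 1) : DiffPoly))).restrictScalars ℝ

theorem coe_dxDer : (dxDer : DiffPoly →ₗ[ℝ] DiffPoly) = dx := by
  refine LinearMap.ext fun f => ?_
  simp only [dxDer, dx, Fin.sum_univ_three]
  rfl

/-- These derivations are only ℝ-linear and may act on the coefficients, so agreement has to be
checked on coefficients as well as on the jet variables. -/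
theorem derivation_ext_diffPoly {D₁ D₂ : Derivation ℝ DiffPoly DiffPoly}
    (hC : ∀ f : Smooth, D₁ (MvPolynomial.C f) = D₂ (MvPolynomial.C f))
    (hX : ∀ j, D₁ (MvPolynomial.X j) = D₂ (MvPolynomial.X j)) : D₁ = D₂ := by
  refine Derivation.ext fun f => ?_
  induction f using MvPolynomial.induction_on with
  | C a => exact hC a
  | add f g hf hg => rw [map_add, map_add, hf, hg]
  | mul_X f j hf => rw [Derivation.leibniz, Derivation.leibniz, hf, hX]

theorem coeffDer_C (α : Fin 3) (f : Smooth) :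
    coeffDer α (MvPolynomial.C f) = MvPolynomial.C (basePartial α f) :=
  coeffPartial_monomial α 0 f

theorem basePartial_one (α : Fin 3) : basePartial α 1 = 0 := by
  have := basePartial_mul α 1 1
  rw [one_mul, one_mul] at this
  exact left_eq_add.1 this

theorem coeffDer_X (α : Fin 3) (j : Fin 3 × ℕ) : coeffDer α (MvPolynomial.X j) = 0 :=
  (coeffPartial_monomial α _ 1).trans (by rw [basePartial_one, map_zero])

theorem jetDer_succ_C (α : Fin 3) (s : ℕ) (f : Smooth) :
    jetDer α (s + 1) (MvPolynomial.C f) = 0 :=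
  MvPolynomial.pderiv_C

theorem jetDer_succ_X (α : Fin 3) (s : ℕ) (j : Fin 3 × ℕ) :
    jetDer α (s + 1) (MvPolynomial.X j) = if j = (α, s) then 1 else 0 := by
  classical
  refine (MvPolynomial.pderiv_X (R := Smooth) (α, s) j).trans ?_
  rw [Pi.single_apply]

theorem dxDer_C (f : Smooth) : dxDer (MvPolynomial.C f)
    = ∑ β : Fin 3, (MvPolynomial.X (β, 0) : DiffPoly) * MvPolynomial.C (basePartial β f) := by
  have h : MvPolynomial.mkDerivation Smooth
      (fun j : Fin 3 × ℕ => (MvPolynomial.X (j.1, j.2 + 1) : DiffPoly)) (MvPolynomial.C f) = 0 :=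
    MvPolynomial.derivation_C _ _
  simp only [dxDer, Fin.sum_univ_three, Derivation.add_apply, Derivation.smul_apply, coeffDer_C,
    smul_eq_mul, Derivation.restrictScalars_apply, h, add_zero]

theorem dxDer_X (j : Fin 3 × ℕ) : dxDer (MvPolynomial.X j) = MvPolynomial.X (j.1, j.2 + 1) := by
  simp only [dxDer, Fin.sum_univ_three, Derivation.add_apply, Derivation.smul_apply, coeffDer_X,
    smul_zero, Derivation.restrictScalars_apply, zero_add, MvPolynomial.mkDerivation_X]

theorem jetDer_zero_comm (α : Fin 3) : ⁅jetDer α 0, dxDer⁆ = 0 := by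
  refine derivation_ext_diffPoly (fun f => ?_) fun j => ?_
  · rw [Derivation.commutator_apply]
    change coeffDer α (dxDer (MvPolynomial.C f)) - dxDer (coeffDer α (MvPolynomial.C f)) = 0
    rw [coeffDer_C, dxDer_C, dxDer_C, map_sum]
    simp only [Derivation.leibniz, coeffDer_X, coeffDer_C, smul_eq_mul, mul_zero, add_zero]
    simp only [basePartial_comm α, sub_self]
  · rw [Derivation.commutator_apply]
    change coeffDer α (dxDer (MvPolynomial.X j)) - dxDer (coeffDer α (MvPolynomial.X j)) = 0
    rw [dxDer_X, coeffDer_X, coeffDer_X, map_zero, sub_zero]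

/-- The variable `X (α, s)` stands for u^{α,s+1}. For s = 0 the commutator comes from the term
u^{α,1} ∂f/∂u^α in ∂_x of a coefficient f; for s > 0 it comes from ∂_x sending u^{α,s} to u^{α,s+1}.
-/
theorem jetDer_succ_comm (α : Fin 3) (s : ℕ) : ⁅jetDer α (s + 1), dxDer⁆ = jetDer α s := by
  refine derivation_ext_diffPoly (fun f => ?_) fun j => ?_
  · rw [Derivation.commutator_apply, dxDer_C, jetDer_succ_C, map_zero, sub_zero, map_sum]
    simp only [Derivation.leibniz, jetDer_succ_C, jetDer_succ_X, zero_add, smul_eq_mul,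
      mul_ite, mul_one, mul_zero, Prod.mk.injEq]
    rcases s with _ | s
    · simp only [and_true, Finset.sum_ite_eq', Finset.mem_univ, if_true]
      exact (coeffDer_C α f).symm
    · rw [jetDer_succ_C]
      exact Finset.sum_eq_zero fun β _ => if_neg (by simp)
  · rw [Derivation.commutator_apply, dxDer_X, jetDer_succ_X, jetDer_succ_X]
    have h0 : dxDer (if j = (α, s) then 1 else 0) = 0 := by split_ifs <;> simp
    rw [h0, sub_zero]
    rcases s with _ | s
    · rw [if_neg (by simp)]
      exact (coeffDer_X α j).symm
    · rw [jetDer_succ_X]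
      obtain ⟨β, r⟩ := j
      simp

/-- The jets of the unknown function `u^α`. -/
def jets (α : Fin 3) : JetSystem DiffPoly where
  D := dxDer
  p := jetDer α
  finite_support f := by
    classical
    refine ((f.vars.image fun j => j.2 + 1).finite_toSet.union (Set.finite_singleton 0)).subset ?_
    intro s hs
    rcases s with _ | s
    · exact Or.inr rfl
    · refine Or.inl ?_
      rw [Finset.mem_coe, Finset.mem_image]
      refine ⟨(α, s), ?_, rfl⟩
      by_contra h
      exact hs (MvPolynomial.pderiv_eq_zero_of_notMem_vars h)
  comm_zero f := by
    have := congrArg (fun d : Derivation ℝ DiffPoly DiffPoly => d f) (jetDer_zero_comm α)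
    simp only [Derivation.commutator_apply, Derivation.zero_apply] at this
    exact sub_eq_zero.1 this
  comm_succ s f := by
    have := congrArg (fun d : Derivation ℝ DiffPoly DiffPoly => d f) (jetDer_succ_comm α s)
    simp only [Derivation.commutator_apply] at this
    exact sub_eq_iff_eq_add'.1 this

/-- The shifts `Λ^j` on `EpsRing`. -/
def sh : ShiftAction EpsRing := shiftAction dxDer

theorem ofSymbol_eq (φ : PowerSeries ℝ) :
    ofSymbol φ = symOp (dxDer : DiffPoly →ₗ[ℝ] DiffPoly) φ := by
  rw [coe_dxDer]
  rfl

theorem shift_apply (j : ℤ) (f : EpsRing) : shift j f = sh.σ j f := by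
  rw [shift, ofSymbol_eq]
  rfl

theorem comp_eq (X Y : DiffOp) : comp X Y = sh.gcomp X Y :=
  funext fun _ => finsum_congr fun i => by rw [shift_apply]

/-- The passage from the sum over jets to the square-zero extension, where varying is a ring
homomorphism followed by an additive functional. -/
theorem varDeriv_eq (α : Fin 3) (h : EpsRing) :
    varDeriv α h = (jets α).varTrace ((jets α).perturbEps h) := by
  refine PowerSeries.ext fun N => ?_
  rw [JetSystem.varTrace_perturbEps, varDeriv, PowerSeries.coeff_mk, varDerivPoly]
  refine finsum_congr fun s => ?_
  change ((-dx) ^ s) _ = ((-(dxDer : DiffPoly →ₗ[ℝ] DiffPoly)) ^ s) (jetDer α s _)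
  rw [coe_dxDer, jetDer_apply]

theorem varDeriv_smul (α : Fin 3) (c : ℝ) (h : EpsRing) :
    varDeriv α (c • h) = c • varDeriv α h := by
  rw [varDeriv_eq, varDeriv_eq, JetSystem.varTrace_perturbEps_smul]

theorem basePartial_baseCoord (α β : Fin 3) :
    basePartial α (baseCoord β) = if α = β then 1 else 0 := by
  ext p
  rw [basePartial_eq_of_eq (g := fun q : Vals => q β) (fun q => rfl),
    show (fun q : Vals => q β) = (ContinuousLinearMap.proj (R := ℝ) (φ := fun _ : Fin 3 => ℝ) β)
      from rfl, ContinuousLinearMap.fderiv, ContinuousLinearMap.proj_apply, Pi.single_apply]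
  split_ifs with h h' h' <;> first | rfl | exact absurd h.symm h' | exact absurd h'.symm h

theorem perturbEps_ofSmooth (α : Fin 3) (f : Smooth) :
    (jets α).perturbEps (ofSmooth f) = JetSystem.incl (ofSmooth f)
      + JetSystem.incl (ofSmooth (basePartial α f)) * JetSystem.delta := by
  unfold JetSystem.perturbEps JetSystem.incl JetSystem.delta ofSmooth
  rw [PowerSeries.map_C, PowerSeries.map_C, PowerSeries.map_C, ← map_mul, ← map_add]
  congr 1
  rw [RingHom.coe_coe, JetSystem.perturb_apply]
  refine TrivSqZeroExt.ext (by simp) (Finsupp.ext fun s => ?_)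
  rcases s with _ | s
  · have h : (jets α).diff (MvPolynomial.C f) 0 = MvPolynomial.C (basePartial α f) := coeffDer_C α f
    simp [h, TrivSqZeroExt.snd_mul]
  · have h : (jets α).diff (MvPolynomial.C f) (s + 1) = 0 := jetDer_succ_C α s f
    simp [h, TrivSqZeroExt.snd_mul]

theorem perturbEps_coord (α β : Fin 3) :
    (jets α).perturbEps (coord β) = JetSystem.incl (coord β)
      + if α = β then JetSystem.delta else 0 := by
  rw [coord, perturbEps_ofSmooth, basePartial_baseCoord]
  congr 1
  split_ifs with h
  · rw [show ofSmooth 1 = 1 by simp [ofSmooth], map_one, one_mul]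
  · rw [show ofSmooth 0 = 0 by simp [ofSmooth], map_zero, zero_mul]

theorem varDeriv_ofSmooth (α : Fin 3) (f : Smooth) :
    varDeriv α (ofSmooth f) = ofSmooth (basePartial α f) := by
  rw [varDeriv_eq, perturbEps_ofSmooth, map_add, JetSystem.varTrace_incl, zero_add,
    JetSystem.varTrace_incl_mul_delta]

/-- The lowest coefficient of A is v; its invertibility gives A⁻¹ in nonnegative powers of Λ. -/
theorem isUnit_v : IsUnit v := by
  have h : IsUnit (baseCoord 1) := by
    refine IsUnit.of_mul_eq_one ⟨fun p => ((p : Vals) 1)⁻¹,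
      contMDiff_of_contDiffAt (g := fun p => (p 1)⁻¹) fun p =>
        ContDiffAt.inv (f := fun q : Vals => q 1) (contDiffAt_pi.1 contDiffAt_id 1) p.2.1⟩ ?_
    ext p
    exact mul_inv_cancel₀ p.2.1
  exact (h.map MvPolynomial.C).map PowerSeries.C

/-! ### Variations of traces of powers -/

section Trace

variable {O O' V : Type*} [Ring O] [Ring O'] [AddCommGroup V] {ι φ : O →+* O'} {t : O' →+ V}

/-- With φ = ι + δ and products of two variations equal to zero, multiplicativity of φ and ι becomes
the Leibniz rule for δ. -/
theorem variation_mul (hsq : ∀ x y, (φ x - ι x) * (φ y - ι y) = 0) (x y : O) :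
    φ (x * y) - ι (x * y) = (φ x - ι x) * ι y + ι x * (φ y - ι y) := by
  have h := hsq x y
  rw [map_mul, map_mul]
  calc φ x * φ y - ι x * ι y
      = (φ x - ι x) * ι y + ι x * (φ y - ι y) + (φ x - ι x) * (φ y - ι y) := by noncomm_ring
    _ = _ := by rw [h, add_zero]

theorem trace_variation_mul (ht : ∀ x y, t (x * y) = t (y * x))
    (hsq : ∀ x y, (φ x - ι x) * (φ y - ι y) = 0) (x y z : O) :
    t (ι z * (φ (x * y) - ι (x * y)))
      = t (ι (y * z) * (φ x - ι x)) + t (ι (z * x) * (φ y - ι y)) := by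
  rw [variation_mul hsq, mul_add, map_add, ← mul_assoc, ht, ← mul_assoc, ← mul_assoc, ← map_mul,
    ← map_mul]

/-- The weight y carries the induction: splitting off one factor x replaces y by xy, which still
commutes with x. -/
theorem trace_variation_pow (ht : ∀ x y, t (x * y) = t (y * x))
    (hsq : ∀ x y, (φ x - ι x) * (φ y - ι y) = 0) {x y : O} (hxy : Commute x y) (n : ℕ) :
    t (ι y * (φ (x ^ (n + 1)) - ι (x ^ (n + 1)))) = (n + 1) • t (ι (y * x ^ n) * (φ x - ι x)) := by
  induction n generalizing y with
  | zero => simp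
  | succ n ih =>
    rw [pow_succ, trace_variation_mul ht hsq, ih ((Commute.refl x).mul_right hxy), hxy.eq, mul_assoc,
      ← pow_succ', ← succ_nsmul]

theorem trace_perturb_pow (ht : ∀ x y, t (x * y) = t (y * x)) (hι : ∀ x, t (ι x) = 0)
    (hsq : ∀ x y, (φ x - ι x) * (φ y - ι y) = 0) (x : O) (n : ℕ) :
    t (φ (x ^ (n + 1))) = (n + 1) • t (ι (x ^ n) * (φ x - ι x)) := by
  have h := trace_variation_pow ht hsq (Commute.one_right x) n
  rwa [map_one, one_mul, one_mul, map_sub, hι, sub_zero] at h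

/-- The variation of the trace of a power of `(B⁻¹A)^{1/2}`. -/
theorem trace_perturb_sqrt_pow (ht : ∀ x y, t (x * y) = t (y * x)) (hι : ∀ x, t (ι x) = 0)
    (hsq : ∀ x y, (φ x - ι x) * (φ y - ι y) = 0) {S A A' B B' : O} (hA : A * A' = 1)
    (hA' : A' * A = 1) (hB : B * B' = 1) (hB' : B' * B = 1) (hS : S * S = B' * A) (n : ℕ) :
    2 • t (φ (S ^ (n + 1))) = (n + 1) • (t (ι (S ^ (n + 1) * A') * (φ A - ι A))
      - t (ι (S ^ (n + 1) * B') * (φ B - ι B))) := by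
  have hBL : B * (S * S) = A := by rw [hS, ← mul_assoc, hB, one_mul]
  have hLA : S * S * A' = B' := by rw [hS, mul_assoc, hA, mul_one]
  have hr : S * S * (A' * B) = 1 := by rw [← mul_assoc, hLA, hB']
  have hl : A' * B * (S * S) = 1 := by rw [mul_assoc, hBL, hA']
  -- A⁻¹B is the two-sided inverse of S², hence commutes with S.
  have hcomm : S * (A' * B) = A' * B * S := by
    calc S * (A' * B) = A' * B * (S * S) * (S * (A' * B)) := by rw [hl, one_mul]
      _ = A' * B * S * (S * S * (A' * B)) := by simp only [mul_assoc]
      _ = A' * B * S := by rw [hr, mul_one]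
  have hYS : S ^ (n + 1) * A' * B * S = S ^ n := by
    rw [mul_assoc, mul_assoc, ← mul_assoc A', ← hcomm, pow_succ, mul_assoc, ← mul_assoc S S, hr,
      mul_one]
  have hSY : S * (S ^ (n + 1) * A' * B) = S ^ n := by
    rw [mul_assoc, ← mul_assoc, ← pow_succ', pow_succ, pow_succ, mul_assoc, mul_assoc,
      ← mul_assoc S S, hr, mul_one]
  have hX : S * S * (S ^ (n + 1) * A') = S ^ (n + 1) * B' := by
    rw [← mul_assoc, ← pow_two, ← pow_add, add_comm, pow_add, pow_two, mul_assoc, hLA]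
  -- The relation A = BS² is varied against the weight S^{n+1}A⁻¹. Its δB term cancels the
  -- subtracted trace, and its two δS terms both carry the weight S^n.
  have h1 : t (ι (S ^ (n + 1) * A') * (φ A - ι A)) - t (ι (S ^ (n + 1) * B') * (φ B - ι B))
      = t (ι (S ^ n) * (φ S - ι S)) + t (ι (S ^ n) * (φ S - ι S)) := by
    conv_lhs => rw [← hBL]
    rw [trace_variation_mul ht hsq, hX, trace_variation_mul ht hsq, hYS, hSY]
    abel
  rw [h1, trace_perturb_pow ht hι hsq, ← two_nsmul, smul_comm]

/-- The variation of the trace of a power of `A⁻¹B`. -/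
theorem trace_perturb_quotient_pow (ht : ∀ x y, t (x * y) = t (y * x)) (hι : ∀ x, t (ι x) = 0)
    (hsq : ∀ x y, (φ x - ι x) * (φ y - ι y) = 0) {A A' B : O} (hA : A * A' = 1)
    (hA' : A' * A = 1) (n : ℕ) :
    t (φ ((A' * B) ^ (n + 1))) = -((n + 1) • (t (ι ((A' * B) ^ (n + 1) * A') * (φ A - ι A))
      - t (ι ((A' * B) ^ n * A') * (φ B - ι B)))) := by
  have hB : A * (A' * B) = B := by rw [← mul_assoc, hA, one_mul]
  rw [trace_perturb_pow ht hι hsq, ← smul_neg]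
  congr 1
  -- Varying B = A(A⁻¹B) against (A⁻¹B)^n A⁻¹ avoids a formula for the variation of A⁻¹.
  have h := trace_variation_mul ht hsq A (A' * B) ((A' * B) ^ n * A')
  rw [hB, ← mul_assoc (A' * B), ← pow_succ', mul_assoc ((A' * B) ^ n), hA', mul_one] at h
  rw [h]
  abel

end Trace

/-! ### Variational derivatives of residues -/

theorem opPow_eq {e : ℤˣ} (X : Ops sh e) (n : ℕ) : opPow X.coeff n = (X ^ n).coeff := by
  induction n with
  | zero => rfl
  | succ n ih =>
    rw [opPow, ih, comp_eq, pow_succ']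
    rfl

section Variation

/-- The operator `aΛ^j`. -/
def Ops.mono {K : Type*} [CommRing K] {s : ShiftAction K} {e : ℤˣ} (a : K) (j : ℤ) : Ops s e :=
  ⟨Pi.single j a, mono_mem a j⟩

theorem Ops.map_mono {K K' : Type*} [CommRing K] [CommRing K'] {s : ShiftAction K}
    {s' : ShiftAction K'} (f : K →+* K') (hf : ∀ i x, f (s.σ i x) = s'.σ i (f x)) {e : ℤˣ}
    (a : K) (j : ℤ) : Ops.map f hf e (Ops.mono a j) = Ops.mono (f a) j := by
  refine Ops.ext fun n => ?_
  change f (Pi.single (M := fun _ => K) j a n) = Pi.single (M := fun _ => K') j (f a) n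
  rw [Pi.single_apply, Pi.single_apply]
  split_ifs <;> simp

theorem Ops.mono_add {K : Type*} [CommRing K] {s : ShiftAction K} {e : ℤˣ} (a b : K) (j : ℤ) :
    (Ops.mono (a + b) j : Ops s e) = Ops.mono a j + Ops.mono b j :=
  Subtype.ext (Pi.single_add (f := fun _ => K) j a b)

/-- The operator `A = Λ² + uΛ + v`. -/
def opA (e : ℤˣ) : Ops sh e := Ops.mono 1 2 + Ops.mono u 1 + Ops.mono v 0

/-- The operator `B = 1 - wΛ⁻¹`. -/
def opB (e : ℤˣ) : Ops sh e := Ops.mono 1 0 - Ops.mono w (-1)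

/-- The candidate `(Λ Z_{-1}, Z_0, Λ⁻¹ W_1)` for a gradient. -/
def gradVec (Z W : DiffOp) : Fin 3 → EpsRing :=
  ![shift 1 (Z (-1)), Z 0, shift (-1) (W 1)]

variable (α : Fin 3) (e : ℤˣ)

/-- The inclusion of the operators into those with variations. -/
def opIncl : Ops sh e →+* Ops (shiftAction (jets α).varD) e :=
  Ops.map JetSystem.incl (jets α).incl_shift e

/-- The map `X ↦ X + δX`. -/
def opPerturb : Ops sh e →+* Ops (shiftAction (jets α).varD) e :=
  Ops.map (jets α).perturbEps (jets α).perturbEps_shift e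

/-- The variation of the integral of the residue, as a coefficient of `δu^α`. -/
def opTrace : Ops (shiftAction (jets α).varD) e →+ EpsRing where
  toFun X := (jets α).varTrace (X.coeff 0)
  map_zero' := map_zero _
  map_add' _ _ := map_add _ _ _

variable {e}

theorem opTrace_comm (X Y : Ops (shiftAction (jets α).varD) e) :
    opTrace α e (X * Y) = opTrace α e (Y * X) :=
  Ops.trace_mul_comm (jets α).varTrace (jets α).varTrace_shift X Y

theorem opTrace_incl (X : Ops sh e) : opTrace α e (opIncl α e X) = 0 :=
  (jets α).varTrace_incl (X.coeff 0)

theorem opTrace_perturb (X : Ops sh e) :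
    opTrace α e (opPerturb α e X) = varDeriv α (res X.coeff) :=
  (varDeriv_eq α _).symm

theorem op_variation_sq (X Y : Ops sh e) :
    (opPerturb α e X - opIncl α e X) * (opPerturb α e Y - opIncl α e Y) = 0 := by
  refine Ops.ext fun n => (finsum_congr fun i => ?_).trans finsum_zero
  change ((jets α).perturbEps (X.coeff i) - JetSystem.incl (X.coeff i)) *
    (shiftAction (jets α).varD).σ i ((jets α).perturbEps (Y.coeff (n - i))
      - JetSystem.incl (Y.coeff (n - i))) = 0
  rw [map_sub, ← JetSystem.perturbEps_shift, ← JetSystem.incl_shift]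
  exact (jets α).sub_mul_sub_eq_zero _ _

/-- The residue of Z δu^β Λ^j is Z_{-j} Λ^{-j}(δu^β); integrating by parts moves the shift onto
Z_{-j}. -/
theorem opTrace_incl_mul_mono (β : Fin 3) (Z : Ops sh e) (j : ℤ) :
    opTrace α e (opIncl α e Z * Ops.mono (if α = β then JetSystem.delta else 0) j)
      = if α = β then shift j (Z.coeff (-j)) else 0 := by
  change (jets α).varTrace ((shiftAction (jets α).varD).gcomp (fun n => JetSystem.incl (Z.coeff n))
    (Pi.single j (if α = β then JetSystem.delta else 0)) 0) = _
  rw [gcomp_single_right]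
  split_ifs
  · rw [JetSystem.varTrace_incl_mul_shift_delta, zero_sub, neg_neg, shift_apply]
    rfl
  · rw [map_zero, mul_zero, map_zero]

theorem opIncl_mono (a : EpsRing) (j : ℤ) :
    opIncl α e (Ops.mono a j) = Ops.mono (JetSystem.incl a) j :=
  Ops.map_mono _ _ a j

theorem opPerturb_mono (a : EpsRing) (j : ℤ) :
    opPerturb α e (Ops.mono a j) = Ops.mono ((jets α).perturbEps a) j :=
  Ops.map_mono _ _ a j

theorem opTrace_incl_mul_variation_opA (Z : Ops sh e) :
    opTrace α e (opIncl α e Z * (opPerturb α e (opA e) - opIncl α e (opA e)))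
      = (if α = 0 then shift 1 (Z.coeff (-1)) else 0) + if α = 1 then Z.coeff 0 else 0 := by
  have h : opPerturb α e (opA e) - opIncl α e (opA e)
      = Ops.mono (if α = 0 then JetSystem.delta else 0) 1
        + Ops.mono (if α = 1 then JetSystem.delta else 0) 0 := by
    have h1 : opIncl α e (opA e) = Ops.mono 1 2 + Ops.mono (JetSystem.incl u) 1
        + Ops.mono (JetSystem.incl v) 0 :=
      (map_add _ _ _).trans (congrArg₂ _ ((map_add _ _ _).trans (congrArg₂ _
        ((opIncl_mono α 1 2).trans (congrArg (fun a => Ops.mono a 2) (map_one _)))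
        (opIncl_mono α u 1))) (opIncl_mono α v 0))
    have h2 : opPerturb α e (opA e) = Ops.mono 1 2
        + (Ops.mono (JetSystem.incl u) 1 + Ops.mono (if α = 0 then JetSystem.delta else 0) 1)
        + (Ops.mono (JetSystem.incl v) 0 + Ops.mono (if α = 1 then JetSystem.delta else 0) 0) :=
      (map_add _ _ _).trans (congrArg₂ _ ((map_add _ _ _).trans (congrArg₂ _
        ((opPerturb_mono α 1 2).trans (congrArg (fun a => Ops.mono a 2) (map_one _)))
        ((opPerturb_mono α u 1).trans ((congrArg (fun a => Ops.mono a 1)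
          (perturbEps_coord α 0)).trans (Ops.mono_add _ _ 1)))))
        ((opPerturb_mono α v 0).trans ((congrArg (fun a => Ops.mono a 0)
          (perturbEps_coord α 1)).trans (Ops.mono_add _ _ 0))))
    rw [h1, h2]
    abel
  have h3 := opTrace_incl_mul_mono α 0 Z 1
  have h4 := opTrace_incl_mul_mono α 1 Z 0
  rw [neg_zero, shift_apply 0, sh.zero_apply] at h4
  exact (congrArg (fun Y => opTrace α e (opIncl α e Z * Y)) h).trans
    ((congrArg (opTrace α e) (mul_add _ _ _)).trans ((map_add (opTrace α e) _ _).trans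
      (congrArg₂ _ h3 h4)))

theorem opTrace_incl_mul_variation_opB (W : Ops sh e) :
    opTrace α e (opIncl α e W * (opPerturb α e (opB e) - opIncl α e (opB e)))
      = -if α = 2 then shift (-1) (W.coeff 1) else 0 := by
  have h : opPerturb α e (opB e) - opIncl α e (opB e)
      = -Ops.mono (if α = 2 then JetSystem.delta else 0) (-1) := by
    have h1 : opIncl α e (opB e) = Ops.mono 1 0 - Ops.mono (JetSystem.incl w) (-1) :=
      (map_sub _ _ _).trans (congrArg₂ _
        ((opIncl_mono α 1 0).trans (congrArg (fun a => Ops.mono a 0) (map_one _)))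
        (opIncl_mono α w (-1)))
    have h2 : opPerturb α e (opB e) = Ops.mono 1 0 - (Ops.mono (JetSystem.incl w) (-1)
        + Ops.mono (if α = 2 then JetSystem.delta else 0) (-1)) :=
      (map_sub _ _ _).trans (congrArg₂ _
        ((opPerturb_mono α 1 0).trans (congrArg (fun a => Ops.mono a 0) (map_one _)))
        ((opPerturb_mono α w (-1)).trans ((congrArg (fun a => Ops.mono a (-1))
          (perturbEps_coord α 2)).trans (Ops.mono_add _ _ (-1)))))
    rw [h1, h2]
    abel
  have h3 := opTrace_incl_mul_mono α 2 W (-1)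
  rw [neg_neg] at h3
  exact (congrArg (fun Y => opTrace α e (opIncl α e W * Y)) h).trans
    ((congrArg (opTrace α e) (mul_neg _ _)).trans ((map_neg (opTrace α e) _).trans
      (congrArg _ h3)))

/-- Since δA = δu Λ + δv and δB = -δw Λ⁻¹, the entries of `gradVec` are the coefficients of δu, δv,
δw in ∫Res(Z δA - W δB). -/
theorem opTrace_gradVec (Z W : Ops sh e) :
    opTrace α e (opIncl α e Z * (opPerturb α e (opA e) - opIncl α e (opA e)))
      - opTrace α e (opIncl α e W * (opPerturb α e (opB e) - opIncl α e (opB e)))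
    = gradVec Z.coeff W.coeff α := by
  rw [opTrace_incl_mul_variation_opA, opTrace_incl_mul_variation_opB]
  fin_cases α <;> simp [gradVec]

theorem varDeriv_res_sqrt_pow {S A' B' : Ops sh 1} (hA : opA 1 * A' = 1) (hA' : A' * opA 1 = 1)
    (hB : opB 1 * B' = 1) (hB' : B' * opB 1 = 1) (hS : S * S = B' * opA 1) (n : ℕ) :
    (2 : ℝ) • varDeriv α (res (S ^ (n + 1)).coeff) = ((n + 1 : ℕ) : ℝ) •
      gradVec (S ^ (n + 1) * A').coeff (S ^ (n + 1) * B').coeff α := by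
  have h := trace_perturb_sqrt_pow (opTrace_comm α) (opTrace_incl α) (op_variation_sq α)
    hA hA' hB hB' hS n
  rw [opTrace_gradVec, opTrace_perturb] at h
  rw [Nat.cast_smul_eq_nsmul, ← h, ← Nat.cast_smul_eq_nsmul ℝ, Nat.cast_ofNat]

theorem varDeriv_res_quotient_pow {A' : Ops sh e} (hA : opA e * A' = 1) (hA' : A' * opA e = 1)
    (n : ℕ) :
    varDeriv α (res ((A' * opB e) ^ (n + 1)).coeff) = -((n + 1 : ℕ) : ℝ) •
      gradVec ((A' * opB e) ^ (n + 1) * A').coeff ((A' * opB e) ^ n * A').coeff α := by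
  have h := trace_perturb_quotient_pow (opTrace_comm α) (opTrace_incl α) (op_variation_sq α)
    (B := opB e) hA hA' n
  rw [opTrace_gradVec, opTrace_perturb] at h
  rw [h, neg_smul, Nat.cast_smul_eq_nsmul]

end Variation

/-! ### The second Hamiltonian operator -/

theorem finite_support_single_right {K : Type*} [CommRing K] (s : ShiftAction K) (X : ℤ → K)
    (a : K) (j n : ℤ) :
    (Function.support fun i => X i * s.σ i (Pi.single (M := fun _ => K) j a (n - i))).Finite := by
  refine (Set.finite_singleton (n - j)).subset fun i hi => ?_
  by_contra h
  refine hi ?_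
  change X i * s.σ i (Pi.single (M := fun _ => K) j a (n - i)) = 0
  rw [Pi.single_eq_of_ne (by intro h'; apply h; rw [Set.mem_singleton_iff]; omega), map_zero,
    mul_zero]

theorem finite_support_single_left {K : Type*} [CommRing K] (s : ShiftAction K) (X : ℤ → K)
    (a : K) (j n : ℤ) :
    (Function.support fun i => Pi.single (M := fun _ => K) j a i * s.σ i (X (n - i))).Finite := by
  refine (Set.finite_singleton j).subset fun i hi => ?_
  by_contra h
  refine hi ?_
  change Pi.single (M := fun _ => K) j a i * s.σ i (X (n - i)) = 0
  rw [Pi.single_eq_of_ne h, zero_mul]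

theorem comp_A (X : DiffOp) (n : ℤ) :
    comp X A n = X (n - 2) + X (n - 1) * sh.σ (n - 1) u + X n * sh.σ n v := by
  have h1 := finite_support_single_right sh X 1 2 n
  have h2 := finite_support_single_right sh X u 1 n
  have h3 := finite_support_single_right sh X v 0 n
  have e1 := gcomp_single_right (s := sh) 1 2 X n
  have e2 := gcomp_single_right (s := sh) u 1 X n
  have e3 := gcomp_single_right (s := sh) v 0 X n
  rw [map_one, mul_one] at e1
  rw [sub_zero] at e3
  rw [← e1, ← e2, ← e3, comp_eq]
  unfold ShiftAction.gcomp
  rw [← finsum_add_distrib h1 h2, ← finsum_add_distrib ((h1.union h2).subset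
    (Function.support_add _ _)) h3]
  refine finsum_congr fun i => ?_
  change X i * sh.σ i (mono 1 2 (n - i) + mono u 1 (n - i) + mono v 0 (n - i)) = _
  rw [map_add, map_add, mul_add, mul_add]
  rfl

theorem A_comp (X : DiffOp) (n : ℤ) :
    comp A X n = sh.σ 2 (X (n - 2)) + u * sh.σ 1 (X (n - 1)) + v * X n := by
  have h1 := finite_support_single_left sh X 1 2 n
  have h2 := finite_support_single_left sh X u 1 n
  have h3 := finite_support_single_left sh X v 0 n
  have e1 := gcomp_single_left (s := sh) 1 2 X n
  have e2 := gcomp_single_left (s := sh) u 1 X n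
  have e3 := gcomp_single_left (s := sh) v 0 X n
  rw [one_mul] at e1
  rw [sub_zero, sh.zero_apply] at e3
  rw [← e1, ← e2, ← e3, comp_eq]
  unfold ShiftAction.gcomp
  rw [← finsum_add_distrib h1 h2, ← finsum_add_distrib ((h1.union h2).subset
    (Function.support_add _ _)) h3]
  refine finsum_congr fun i => ?_
  change (mono 1 2 i + mono u 1 i + mono v 0 i) * sh.σ i (X (n - i)) = _
  rw [add_mul, add_mul]
  rfl

theorem comp_B (X : DiffOp) (n : ℤ) : comp X B n = X n - X (n + 1) * sh.σ (n + 1) w := by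
  have h1 := finite_support_single_right sh X 1 0 n
  have h2 := finite_support_single_right sh X w (-1) n
  have e1 := gcomp_single_right (s := sh) 1 0 X n
  have e2 := gcomp_single_right (s := sh) w (-1) X n
  rw [map_one, mul_one, sub_zero] at e1
  rw [sub_neg_eq_add] at e2
  rw [← e1, ← e2, comp_eq]
  unfold ShiftAction.gcomp
  rw [← finsum_sub_distrib h1 h2]
  refine finsum_congr fun i => ?_
  change X i * sh.σ i (mono 1 0 (n - i) - mono w (-1) (n - i)) = _
  rw [map_sub, mul_sub]
  rfl

theorem B_comp (X : DiffOp) (n : ℤ) : comp B X n = X n - w * sh.σ (-1) (X (n + 1)) := by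
  have h1 := finite_support_single_left sh X 1 0 n
  have h2 := finite_support_single_left sh X w (-1) n
  have e1 := gcomp_single_left (s := sh) 1 0 X n
  have e2 := gcomp_single_left (s := sh) w (-1) X n
  rw [one_mul, sub_zero, sh.zero_apply] at e1
  rw [sub_neg_eq_add] at e2
  rw [← e1, ← e2, comp_eq]
  unfold ShiftAction.gcomp
  rw [← finsum_sub_distrib h1 h2]
  refine finsum_congr fun i => ?_
  change (mono 1 0 i - mono w (-1) i) * sh.σ i (X (n - i)) = _
  rw [sub_mul]
  rfl

theorem ofSymbol_mul_apply (φ ψ : PowerSeries ℝ) (f : EpsRing) :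
    ofSymbol (φ * ψ) f = ofSymbol φ (ofSymbol ψ f) := by
  rw [ofSymbol_eq, ofSymbol_eq, ofSymbol_eq, symOp_mul, Module.End.mul_apply]

theorem ofSymbol_add_apply (φ ψ : PowerSeries ℝ) (f : EpsRing) :
    ofSymbol (φ + ψ) f = ofSymbol φ f + ofSymbol ψ f := by
  rw [ofSymbol_eq, ofSymbol_eq, ofSymbol_eq, symOp_add, LinearMap.add_apply]

theorem ofSymbol_sub_apply (φ ψ : PowerSeries ℝ) (f : EpsRing) :
    ofSymbol (φ - ψ) f = ofSymbol φ f - ofSymbol ψ f := by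
  rw [ofSymbol_eq, ofSymbol_eq, ofSymbol_eq, symOp_sub, LinearMap.sub_apply]

theorem ofSymbol_one_apply (f : EpsRing) : ofSymbol 1 f = f := by
  rw [ofSymbol_eq, symOp_one, Module.End.one_apply]

theorem ofSymbol_expSymbol (j : ℤ) (f : EpsRing) : ofSymbol (expSymbol j) f = sh.σ j f :=
  shift_apply j f

theorem expSymbol_one_mul_neg_one : expSymbol 1 * expSymbol (-1) = 1 := by
  rw [← expSymbol_add, add_neg_cancel, expSymbol_zero]

theorem expSymbol_two : expSymbol 2 = expSymbol 1 * expSymbol 1 := by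
  rw [← expSymbol_add]
  norm_num

theorem inv_one_add_expSymbol_neg_one :
    (1 + expSymbol (-1))⁻¹ = expSymbol 1 * (1 + expSymbol 1)⁻¹ := by
  have h1 := one_add_expSymbol_mul_inv 1
  have h2 := one_add_expSymbol_mul_inv (-1)
  have h3 := expSymbol_one_mul_neg_one
  linear_combination (expSymbol 1 * (1 + expSymbol 1)⁻¹) * h2 - (1 + expSymbol (-1))⁻¹ * h1
    - (1 + expSymbol (-1))⁻¹ * (1 + expSymbol 1)⁻¹ * h3

/-- If `(Λ-1)c = (Λ²-1)z + (1-Λ⁻¹)a`, then `(Λ²-Λ)z` is `(1-Λ)/(1+Λ) a + (Λ-1)/(1+Λ⁻¹) c`. -/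
theorem ofSymbol_solve {a c z : EpsRing}
    (h : ofSymbol (expSymbol 1 - 1) c
      = ofSymbol (expSymbol 2 - 1) z + ofSymbol (1 - expSymbol (-1)) a) :
    ofSymbol ((1 - expSymbol 1) * (1 + expSymbol 1)⁻¹) a
      + ofSymbol ((expSymbol 1 - 1) * (1 + expSymbol (-1))⁻¹) c = sh.σ 2 z - sh.σ 1 z := by
  have h1 := one_add_expSymbol_mul_inv 1
  have h3 := expSymbol_one_mul_neg_one
  -- Both fractions are Λ/(1+Λ) times an operator from the hypothesis, namely -(1-Λ⁻¹) and Λ-1. What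
  -- remains after inserting the hypothesis is Λ(Λ²-1)/(1+Λ) = Λ²-Λ, without denominator.
  have e1 : (1 - expSymbol 1) * (1 + expSymbol 1)⁻¹
      = 0 - expSymbol 1 * (1 + expSymbol 1)⁻¹ * (1 - expSymbol (-1)) := by
    linear_combination (-(1 + expSymbol 1)⁻¹) * h3
  have e2 : (expSymbol 1 - 1) * (1 + expSymbol (-1))⁻¹
      = expSymbol 1 * (1 + expSymbol 1)⁻¹ * (expSymbol 1 - 1) := by
    rw [inv_one_add_expSymbol_neg_one]
    ring
  have e3 : expSymbol 1 * (1 + expSymbol 1)⁻¹ * (expSymbol 2 - 1) = expSymbol 2 - expSymbol 1 := by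
    rw [expSymbol_two]
    linear_combination (expSymbol 1 * (expSymbol 1 - 1)) * h1
  have h0 : ofSymbol 0 a = 0 := by
    have := ofSymbol_sub_apply 1 1 a
    rwa [sub_self, sub_self] at this
  rw [e1, e2, ofSymbol_sub_apply, ofSymbol_mul_apply (expSymbol 1 * _) (1 - _),
    ofSymbol_mul_apply (expSymbol 1 * _) (expSymbol 1 - 1), h, map_add,
    ← ofSymbol_mul_apply _ (expSymbol 2 - 1), e3, ofSymbol_sub_apply (expSymbol 2) (expSymbol 1), ofSymbol_expSymbol, ofSymbol_expSymbol, h0]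
  abel

theorem sum_P2_zero (f : Fin 3 → EpsRing) : ∑ β, P2 0 β (f β)
    = sh.σ 1 (v * f 0) - v * sh.σ (-1) (f 0)
      + u * (ofSymbol ((1 - expSymbol 1) * (1 + expSymbol 1)⁻¹) (u * f 0)
        + ofSymbol ((expSymbol 1 - 1) * (1 + expSymbol (-1))⁻¹) (w * f 2)) := by
  rw [Fin.sum_univ_three]
  change shift 1 (v * f 0) - v * shift (-1) (f 0)
      + u * ofSymbol ((1 - expSymbol 1) * (1 + expSymbol 1)⁻¹) (u * f 0) + 0
      + u * ofSymbol ((expSymbol 1 - 1) * (1 + expSymbol (-1))⁻¹) (w * f 2) = _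
  rw [shift_apply, shift_apply]
  ring

theorem sum_P2_one (f : Fin 3 → EpsRing) :
    ∑ β, P2 1 β (f β) = v * (sh.σ 1 (w * f 2) - w * f 2) := by
  rw [Fin.sum_univ_three]
  change 0 + 0 + v * (shift 1 (w * f 2) - w * f 2) = _
  rw [shift_apply]
  ring

theorem sum_P2_two (f : Fin 3 → EpsRing) : ∑ β, P2 2 β (f β)
    = w * (ofSymbol ((1 - expSymbol (-1)) * (expSymbol 1 + 1)⁻¹) (u * f 0)
      + (v * f 1 - sh.σ (-1) (v * f 1))
      + ofSymbol ((expSymbol 2 - expSymbol (-1)) * (expSymbol 1 + 1)⁻¹) (w * f 2)) := by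
  rw [Fin.sum_univ_three]
  change w * ofSymbol ((1 - expSymbol (-1)) * (expSymbol 1 + 1)⁻¹) (u * f 0)
      + w * (v * f 1 - shift (-1) (v * f 1))
      + w * ofSymbol ((expSymbol 2 - expSymbol (-1)) * (expSymbol 1 + 1)⁻¹) (w * f 2) = _
  rw [shift_apply]
  ring

theorem coeff_zero_ofSymbol (φ : PowerSeries ℝ) (f : EpsRing) :
    PowerSeries.coeff 0 (ofSymbol φ f) = PowerSeries.coeff 0 φ • PowerSeries.coeff 0 f := by
  rw [ofSymbol_eq, coeff_zero_symOp]

theorem coeff_zero_expSymbol (j : ℤ) : PowerSeries.coeff 0 (expSymbol j) = 1 := by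
  rw [coeff_expSymbol]
  simp

theorem coeff_zero_shift (j : ℤ) (f : EpsRing) :
    PowerSeries.coeff 0 (sh.σ j f) = PowerSeries.coeff 0 f := by
  rw [← ofSymbol_expSymbol, coeff_zero_ofSymbol, coeff_zero_expSymbol, one_smul]

theorem coeff_zero_mul_eq {K : Type*} [CommRing K] (f g : PowerSeries K) :
    PowerSeries.coeff 0 (f * g) = PowerSeries.coeff 0 f * PowerSeries.coeff 0 g := by
  simp only [PowerSeries.coeff_zero_eq_constantCoeff_apply, map_mul]

/-- The operator `𝒫₂` is divisible by `ε`. -/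
theorem eps_dvd_sum_P2 (α : Fin 3) (f : Fin 3 → EpsRing) : eps ∣ ∑ β, P2 α β (f β) := by
  rw [eps, PowerSeries.X_dvd_iff, ← PowerSeries.coeff_zero_eq_constantCoeff_apply]
  have hmul : ∀ φ ψ : PowerSeries ℝ, PowerSeries.coeff 0 φ = 0 →
      ∀ f : EpsRing, PowerSeries.coeff 0 (ofSymbol (φ * ψ) f) = 0 := fun φ ψ h f => by
    rw [coeff_zero_ofSymbol, coeff_zero_mul_eq, h, zero_mul, zero_smul]
  have h1 : PowerSeries.coeff 0 (1 - expSymbol 1) = 0 := by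
    rw [map_sub, coeff_zero_expSymbol, PowerSeries.coeff_zero_one, sub_self]
  have h2 : PowerSeries.coeff 0 (expSymbol 1 - 1) = 0 := by
    rw [map_sub, coeff_zero_expSymbol, PowerSeries.coeff_zero_one, sub_self]
  have h3 : PowerSeries.coeff 0 (1 - expSymbol (-1)) = 0 := by
    rw [map_sub, coeff_zero_expSymbol, PowerSeries.coeff_zero_one, sub_self]
  have h4 : PowerSeries.coeff 0 (expSymbol 2 - expSymbol (-1)) = 0 := by
    rw [map_sub, coeff_zero_expSymbol, coeff_zero_expSymbol, sub_self]
  fin_cases α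
  · refine (congrArg _ (sum_P2_zero f)).trans ?_
    rw [map_add, map_sub, coeff_zero_mul_eq, coeff_zero_mul_eq, map_add,
      hmul _ _ h1, hmul _ _ h2, coeff_zero_shift, coeff_zero_shift, coeff_zero_mul_eq]
    ring
  · refine (congrArg _ (sum_P2_one f)).trans ?_
    rw [coeff_zero_mul_eq, map_sub, coeff_zero_shift]
    ring
  · refine (congrArg _ (sum_P2_two f)).trans ?_
    rw [coeff_zero_mul_eq, map_add, map_add, map_sub, hmul _ _ h3, hmul _ _ h4,
      coeff_zero_shift]
    ring

/-- The relations between the operators from which the flows and the gradients are formed. -/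
structure Factorization (X X' Z W : DiffOp) : Prop where
  comp_Z_A : comp Z A = X
  comp_A_Z : comp A Z = X'
  comp_W_B : comp W B = X
  comp_B_W : comp B W = X'
  comp_A : comp X' A = comp A X
  comp_B : comp X' B = comp B X

/-! ### From a factorization to the Lax equations -/

namespace Factorization

variable {X X' Z W : DiffOp}

theorem X_apply_zero (F : Factorization X X' Z W) :
    X 0 = Z (-2) + sh.σ (-1) (u * gradVec Z W 0) + v * gradVec Z W 1 := by
  rw [← F.comp_Z_A, RR2T.comp_A, sh.zero_apply]
  change _ = Z (-2) + sh.σ (-1) (u * shift 1 (Z (-1))) + v * Z 0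
  rw [shift_apply, map_mul, sh.neg_apply_apply, zero_sub, zero_sub]
  ring

theorem X'_apply_zero (F : Factorization X X' Z W) :
    X' 0 = sh.σ 2 (Z (-2)) + u * gradVec Z W 0 + v * gradVec Z W 1 := by
  rw [← F.comp_A_Z, A_comp, zero_sub, zero_sub, ← shift_apply 1]
  rfl

theorem X_apply_zero_eq_W (F : Factorization X X' Z W) :
    X 0 = W 0 - sh.σ 1 (w * gradVec Z W 2) := by
  rw [← F.comp_W_B, RR2T.comp_B]
  change _ = W 0 - sh.σ 1 (w * shift (-1) (W 1))
  rw [shift_apply, map_mul, sh.apply_neg_apply, zero_add, mul_comm]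

theorem X'_apply_zero_eq_W (F : Factorization X X' Z W) : X' 0 = W 0 - w * gradVec Z W 2 := by
  rw [← F.comp_B_W, B_comp, zero_add, ← shift_apply (-1)]
  rfl

/-- X'₀ - X₀ is computed twice. The expressions through Z lose the δ/δv component, those through W
lose W₀, and equating the two leaves Z₋₂ as the only unknown outside the gradient. -/
theorem symbol_relation (F : Factorization X X' Z W) :
    ofSymbol (expSymbol 1 - 1) (w * gradVec Z W 2)
      = ofSymbol (expSymbol 2 - 1) (Z (-2))
        + ofSymbol (1 - expSymbol (-1)) (u * gradVec Z W 0) := by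
  rw [ofSymbol_sub_apply, ofSymbol_sub_apply, ofSymbol_sub_apply, ofSymbol_one_apply,
    ofSymbol_one_apply, ofSymbol_one_apply, ofSymbol_expSymbol, ofSymbol_expSymbol,
    ofSymbol_expSymbol]
  linear_combination F.X'_apply_zero - F.X_apply_zero - F.X'_apply_zero_eq_W + F.X_apply_zero_eq_W

/-- In Λ²X₋₁ - X'₋₁ the coefficient Z₋₃ cancels and Z₋₂ occurs only in u(Λ²-Λ)Z₋₂, which
`ofSymbol_solve` identifies with the rational entries of the first row. -/
theorem sum_P2_gradVec_zero (F : Factorization X X' Z W) :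
    ∑ β, P2 0 β (gradVec Z W β) = sh.σ 2 (X (-1)) - X' (-1) := by
  have h0 : gradVec Z W 0 = sh.σ 1 (Z (-1)) := shift_apply 1 _
  have h2 : ∀ x, sh.σ 2 x = sh.σ 1 (sh.σ 1 x) := fun x => by rw [← sh.add_apply]; rfl
  have hX : sh.σ 2 (X (-1)) = sh.σ 2 (Z (-3)) + sh.σ 2 (Z (-2)) * u
      + sh.σ 2 (Z (-1)) * sh.σ 1 v := by
    rw [← F.comp_Z_A, RR2T.comp_A, map_add, map_add, map_mul, map_mul, ← sh.add_apply 2 (-1 - 1),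
      ← sh.add_apply 2 (-1)]
    norm_num
    rw [sh.zero_apply]
  have hX' : X' (-1) = sh.σ 2 (Z (-3)) + u * sh.σ 1 (Z (-2)) + v * Z (-1) := by
    rw [← F.comp_A_Z, A_comp]
    norm_num
  rw [sum_P2_zero, ofSymbol_solve F.symbol_relation, hX, hX', h0, sh.neg_apply_apply, map_mul,
    ← h2]
  ring

theorem sum_P2_gradVec_one (F : Factorization X X' Z W) :
    ∑ β, P2 1 β (gradVec Z W β) = v * (X' 0 - X 0) := by
  rw [sum_P2_one]
  linear_combination v * F.X_apply_zero_eq_W - v * F.X'_apply_zero_eq_W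

theorem sum_P2_gradVec_two (F : Factorization X X' Z W) :
    ∑ β, P2 2 β (gradVec Z W β) = w * (X' 0 - sh.σ (-1) (X 0)) := by
  have h1 := one_add_expSymbol_mul_inv 1
  have h3 := expSymbol_one_mul_neg_one
  -- The fractions of the third row are those of the first plus 1 - Λ⁻¹, so the same solution of the
  -- relation serves again.
  have e1 : (1 - expSymbol (-1)) * (expSymbol 1 + 1)⁻¹
      = 1 - expSymbol (-1) + (1 - expSymbol 1) * (1 + expSymbol 1)⁻¹ := by
    rw [add_comm (expSymbol 1)]
    linear_combination (1 - expSymbol (-1)) * h1 + (1 + expSymbol 1)⁻¹ * h3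
  have e2 : (expSymbol 2 - expSymbol (-1)) * (expSymbol 1 + 1)⁻¹
      = 1 - expSymbol (-1) + (expSymbol 1 - 1) * (1 + expSymbol (-1))⁻¹ := by
    rw [add_comm (expSymbol 1), inv_one_add_expSymbol_neg_one, expSymbol_two]
    linear_combination (1 - expSymbol (-1)) * h1 + (1 + expSymbol 1)⁻¹ * h3
  have h2 : sh.σ 1 (Z (-2)) = sh.σ (-1) (sh.σ 2 (Z (-2))) := by rw [← sh.add_apply]; rfl
  have hW : W 0 = w * gradVec Z W 2 + (sh.σ 2 (Z (-2)) + u * gradVec Z W 0 + v * gradVec Z W 1) := by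
    linear_combination F.X'_apply_zero - F.X'_apply_zero_eq_W
  have hs := ofSymbol_solve F.symbol_relation
  have hX : sh.σ (-1) (X 0) = sh.σ (-1) (W 0) - w * gradVec Z W 2 := by
    rw [F.X_apply_zero_eq_W, map_sub, sh.neg_apply_apply]
  rw [sum_P2_two, e1, e2, ofSymbol_add_apply, ofSymbol_add_apply, ofSymbol_sub_apply 1,
    ofSymbol_sub_apply 1, ofSymbol_one_apply, ofSymbol_one_apply, ofSymbol_expSymbol,
    ofSymbol_expSymbol, hX, F.X'_apply_zero_eq_W, hW, map_add, map_add, map_add, ← h2]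
  linear_combination w * hs

/-- Below Λ⁰ every term is truncated away, and from Λ² on truncation is invisible and X'A = AX
applies. Only Λ⁰ and Λ¹ mix kept and dropped coefficients, and there the sums over 𝒫₂ appear. -/
theorem lax_A (F : Factorization X X' Z W) (n : ℤ) :
    comp (posPart X') A n - comp A (posPart X) n
      = dotA (fun α => ∑ β, P2 α β (gradVec Z W β)) n := by
  have hfull := congrFun F.comp_A n
  rw [RR2T.comp_A, A_comp] at hfull ⊢
  change _ = mono (∑ β, P2 0 β (gradVec Z W β)) 1 n + mono (∑ β, P2 1 β (gradVec Z W β)) 0 n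
  rw [F.sum_P2_gradVec_zero, F.sum_P2_gradVec_one]
  rcases lt_trichotomy n 0 with hn | rfl | hn
  · simp only [posPart, mono]
    rw [if_neg (by omega), if_neg (by omega), if_neg (by omega), if_neg (by omega),
      if_neg (by omega), if_neg (by omega), Pi.single_eq_of_ne (by omega),
      Pi.single_eq_of_ne (by omega)]
    simp
  · simp only [posPart, mono]
    norm_num
    rw [sh.zero_apply]
    ring
  · rcases eq_or_lt_of_le (show 1 ≤ n by omega) with rfl | hn1
    · simp only [posPart, mono]
      norm_num at hfull ⊢
      linear_combination hfull
    · simp only [posPart, mono]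
      rw [if_pos (by omega), if_pos (by omega), if_pos (by omega), if_pos (by omega),
        if_pos (by omega), if_pos (by omega), Pi.single_eq_of_ne (by omega),
        Pi.single_eq_of_ne (by omega), hfull]
      simp

theorem lax_B (F : Factorization X X' Z W) (n : ℤ) :
    comp (posPart X') B n - comp B (posPart X) n
      = dotB (fun α => ∑ β, P2 α β (gradVec Z W β)) n := by
  have hfull := congrFun F.comp_B n
  rw [RR2T.comp_B, B_comp] at hfull ⊢
  change _ = -mono (∑ β, P2 2 β (gradVec Z W β)) (-1) n
  rw [F.sum_P2_gradVec_two]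
  rcases lt_trichotomy n (-1) with hn | rfl | hn
  · simp only [posPart, mono]
    rw [if_neg (by omega), if_neg (by omega), if_neg (by omega), if_neg (by omega),
      Pi.single_eq_of_ne (by omega)]
    simp
  · simp only [posPart, mono]
    norm_num
    rw [sh.zero_apply]
    ring
  · simp only [posPart, mono]
    rw [if_pos (by omega), if_pos (by omega), if_pos (by omega), if_pos (by omega),
      Pi.single_eq_of_ne (by omega), hfull]
    simp

theorem negPart_apply (Y : DiffOp) (n : ℤ) : negPart Y n = Y n - posPart Y n := by
  unfold negPart posPart
  split_ifs <;> first | omega | simp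

/-- The full expression X'A - AX vanishes, so the negative parts contribute the opposite of the
positive parts. -/
theorem lax_A_neg (F : Factorization X X' Z W) (n : ℤ) :
    comp (negPart X') A n - comp A (negPart X) n
      = -dotA (fun α => ∑ β, P2 α β (gradVec Z W β)) n := by
  have hfull := congrFun F.comp_A n
  have h := F.lax_A n
  rw [RR2T.comp_A, A_comp] at h hfull ⊢
  simp only [negPart_apply, map_sub]
  linear_combination hfull - h

theorem lax_B_neg (F : Factorization X X' Z W) (n : ℤ) :
    comp (negPart X') B n - comp B (negPart X) n
      = -dotB (fun α => ∑ β, P2 α β (gradVec Z W β)) n := by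
  have hfull := congrFun F.comp_B n
  have h := F.lax_B n
  rw [RR2T.comp_B, B_comp] at h hfull ⊢
  simp only [negPart_apply, map_sub]
  linear_combination hfull - h

theorem dot_iff (T G : Fin 3 → EpsRing) (c : ℝ) :
    ((∀ n, eps * dotA T n = c • dotA G n) ∧ ∀ n, eps * dotB T n = c • dotB G n)
      ↔ ∀ α, eps * T α = c • G α := by
  constructor
  · rintro ⟨hA, hB⟩ α
    have h0 := hA 1
    have h1 := hA 0
    have h2 := hB (-1)
    simp only [dotA, dotB, mono, Pi.add_apply, Pi.neg_apply, Pi.single_eq_same,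
      Pi.single_eq_of_ne (show (1 : ℤ) ≠ 0 by norm_num),
      Pi.single_eq_of_ne (show (0 : ℤ) ≠ 1 by norm_num), add_zero, zero_add, mul_neg, smul_neg,
      neg_inj] at h0 h1 h2
    fin_cases α
    · exact h0
    · exact h1
    · exact h2
  · intro h
    refine ⟨fun n => ?_, fun n => ?_⟩
    · simp only [dotA, mono, Pi.add_apply, Pi.single_apply, mul_add, smul_add, mul_ite, mul_zero,
        smul_ite, smul_zero, h]
    · simp only [dotB, mono, Pi.neg_apply, Pi.single_apply, mul_neg, smul_neg, mul_ite, mul_zero,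
        smul_ite, smul_zero, h]

theorem laxPair_posPart_iff (F : Factorization X X' Z W) (c : ℝ) (T : Fin 3 → EpsRing) :
    LaxPair c (posPart X') (posPart X) T
      ↔ ∀ α, eps * T α = c • ∑ β, P2 α β (gradVec Z W β) := by
  unfold LaxPair
  simp only [F.lax_A, F.lax_B]
  exact dot_iff T _ c

theorem laxPair_negPart_iff (F : Factorization X X' Z W) (c : ℝ) (T : Fin 3 → EpsRing) :
    LaxPair c (negPart X') (negPart X) T
      ↔ ∀ α, eps * T α = (-c) • ∑ β, P2 α β (gradVec Z W β) := by
  unfold LaxPair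
  simp only [F.lax_A_neg, F.lax_B_neg, smul_neg, ← neg_smul]
  exact dot_iff T _ (-c)

end Factorization

theorem eps_mul_cancel {f g : EpsRing} (h : eps * f = eps * g) : f = g :=
  PowerSeries.X_mul_cancel h

/-- If the flow is proportional to `𝒫₂ h` and the gradient to `h`, then the flow exists, is unique
and is the Hamiltonian one. -/
theorem flow_of_iff {κ c : ℝ} (hκ : κ ≠ 0) {P : (Fin 3 → EpsRing) → Prop} {h d : Fin 3 → EpsRing}
    (hP : ∀ T, P T ↔ ∀ α, eps * T α = c • ∑ β, P2 α β (h β)) (hd : ∀ α, d α = (κ * c) • h α) :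
    (∃! T, P T) ∧ ∀ T, P T ↔ ∀ α, κ • (eps * T α) = ∑ β, P2 α β (d β) := by
  refine ⟨?_, fun T => ?_⟩
  -- G is 𝒫₂h divided by ε, so the flow is cG.
  · choose G hG using fun α => eps_dvd_sum_P2 α h
    refine ⟨fun α => c • G α, (hP _).2 fun α => ?_, fun T hT => funext fun α => ?_⟩
    · rw [hG, mul_smul_comm]
    · refine eps_mul_cancel ?_
      rw [(hP T).1 hT α, hG, mul_smul_comm]
  · rw [hP]
    refine forall_congr' fun α => ?_
    simp only [hd, map_smul, ← Finset.smul_sum, mul_smul]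
    exact (smul_right_injective _ hκ).eq_iff.symm

/-! ### The operators of the hierarchy -/

theorem A_of_ne {n : ℤ} (h0 : n ≠ 0) (h1 : n ≠ 1) (h2 : n ≠ 2) : A n = 0 := by
  simp [A, mono, h0, h1, h2]

theorem A_two : A 2 = 1 := by simp [A, mono]

theorem A_zero : A 0 = v := by simp [A, mono]

theorem B_of_pos {n : ℤ} (h : 0 < n) : B n = 0 := by
  simp [B, mono, show n ≠ 0 by omega, show n ≠ -1 by omega]

theorem B_zero : B 0 = 1 := by simp [B, mono]

theorem Binv_spec : (∀ n : ℤ, 0 < n → Binv n = 0) ∧ comp B Binv = idOp ∧ comp Binv B = idOp := by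
  refine Classical.epsilon_spec
    (p := fun Y : DiffOp => (∀ n : ℤ, 0 < n → Y n = 0) ∧ comp B Y = idOp ∧ comp Y B = idOp) ?_
  obtain ⟨Y, hY, h1, h2⟩ := exists_inverse (s := sh) (e := 1) (X := B) (d := 0)
    (fun n hn => B_of_pos (by simpa using hn)) (by rw [B_zero]; exact isUnit_one)
  refine ⟨Y, fun n hn => hY n (by simpa using hn), ?_, ?_⟩
  · rw [comp_eq]; exact h1
  · rw [comp_eq]; exact h2

theorem Ainv_spec : (∀ n : ℤ, n < 0 → Ainv n = 0) ∧ comp A Ainv = idOp ∧ comp Ainv A = idOp := by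
  refine Classical.epsilon_spec
    (p := fun Y : DiffOp => (∀ n : ℤ, n < 0 → Y n = 0) ∧ comp A Y = idOp ∧ comp Y A = idOp) ?_
  obtain ⟨Y, hY, h1, h2⟩ := exists_inverse (s := sh) (e := -1) (X := A) (d := 0)
    (fun n hn => by
      have : n < 0 := by simpa using hn
      exact A_of_ne (by omega) (by omega) (by omega)) (by rw [A_zero]; exact isUnit_v)
  refine ⟨Y, fun n hn => hY n (by simpa using hn), ?_, ?_⟩
  · rw [comp_eq]; exact h1
  · rw [comp_eq]; exact h2

/-- `B⁻¹` in the ring of operators with bounded positive powers. -/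
def opBinv : Ops sh 1 := ⟨Binv, mem_boundedOps_of_lt (d := 0) fun n hn =>
  Binv_spec.1 n (by simpa using hn)⟩

/-- `A⁻¹` in the ring of operators with bounded negative powers. -/
def opAinv : Ops sh (-1) := ⟨Ainv, mem_boundedOps_of_lt (d := 0) fun n hn =>
  Ainv_spec.1 n (by simpa using hn)⟩

theorem opB_mul_opBinv : opB 1 * opBinv = 1 :=
  Ops.coeff_injective ((comp_eq _ _).symm.trans Binv_spec.2.1)

theorem opBinv_mul_opB : opBinv * opB 1 = 1 :=
  Ops.coeff_injective ((comp_eq _ _).symm.trans Binv_spec.2.2)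

theorem opA_mul_opAinv : opA (-1) * opAinv = 1 :=
  Ops.coeff_injective ((comp_eq _ _).symm.trans Ainv_spec.2.1)

theorem opAinv_mul_opA : opAinv * opA (-1) = 1 :=
  Ops.coeff_injective ((comp_eq _ _).symm.trans Ainv_spec.2.2)

/-- The operator `A` also has an inverse with bounded positive powers. -/
theorem exists_opA_inverse : ∃ A' : Ops sh 1, opA 1 * A' = 1 ∧ A' * opA 1 = 1 := by
  obtain ⟨Y, hY, h1, h2⟩ := exists_inverse (s := sh) (e := 1) (X := A) (d := 2)
    (fun n hn => by
      have : 2 < n := by simpa using hn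
      exact A_of_ne (by omega) (by omega) (by omega)) (by rw [A_two]; exact isUnit_one)
  exact ⟨⟨Y, mem_boundedOps_of_lt hY⟩, Ops.coeff_injective h1, Ops.coeff_injective h2⟩

theorem coeff_opBinv_mul_opA : (opBinv * opA 1).coeff = L := (comp_eq _ _).symm

theorem coeff_opA_mul_opBinv : (opA 1 * opBinv).coeff = Ltilde := (comp_eq _ _).symm

theorem coeff_opAinv_mul_opB : (opAinv * opB (-1)).coeff = M := (comp_eq _ _).symm

theorem coeff_opB_mul_opAinv : (opB (-1) * opAinv).coeff = Mtilde := (comp_eq _ _).symm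

/-- The coefficients of a product, with bounds on the powers in the factors. -/
theorem comp_leading {X Y : DiffOp} {d d' : ℤ} (hX : ∀ n, d < n → X n = 0)
    (hY : ∀ n, d' < n → Y n = 0) :
    (∀ n, d + d' < n → comp X Y n = 0) ∧ comp X Y (d + d') = X d * sh.σ d (Y d') := by
  have hX' : ∀ n, 0 < ((1 : ℤˣ) : ℤ) * (n - d) → X n = 0 := fun n hn =>
    hX n (by simpa using hn)
  have hY' : ∀ n, 0 < ((1 : ℤˣ) : ℤ) * (n - d') → Y n = 0 := fun n hn =>
    hY n (by simpa using hn)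
  rw [comp_eq]
  refine ⟨fun n hn => gcomp_apply_of_lt hX' hY' (by rw [Units.val_one, one_mul]; omega), ?_⟩
  simpa using gcomp_apply_sub (s := sh) hX' hY' 0

theorem Binv_zero : Binv 0 = 1 := by
  have h := congrFun Binv_spec.2.1 0
  rw [B_comp, zero_add, Binv_spec.1 1 one_pos, map_zero, mul_zero, sub_zero] at h
  exact h

theorem A_of_two_lt {n : ℤ} (h : 2 < n) : A n = 0 :=
  A_of_ne (by omega) (by omega) (by omega)

theorem sqrtOp_spec {X : DiffOp} (hX : ∀ n, 2 < n → X n = 0) (h2 : X 2 = 1) :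
    (∀ n : ℤ, 1 < n → sqrtOp X n = 0) ∧ sqrtOp X 1 = 1 ∧ comp (sqrtOp X) (sqrtOp X) = X := by
  refine Classical.epsilon_spec
    (p := fun R : DiffOp => (∀ n : ℤ, 1 < n → R n = 0) ∧ R 1 = 1 ∧ comp R R = X) ?_
  obtain ⟨R, h⟩ := exists_sqrt (s := sh) (one_add_shift_bijective dxDer).2 hX h2
  exact ⟨R, by rw [comp_eq]; exact h⟩

/-- A square of an operator of this form has leading term Λ², so the chosen root satisfies its
specification and uniqueness identifies it with R. -/
theorem sqrtOp_eq {X R : DiffOp} (hR : ∀ n, 1 < n → R n = 0) (h1 : R 1 = 1) (h : comp R R = X) :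
    sqrtOp X = R := by
  have hX := comp_leading hR hR
  rw [h, h1, map_one, mul_one] at hX
  have hs := sqrtOp_spec hX.1 hX.2
  refine sqrt_unique (s := sh) (one_add_shift_bijective dxDer).1 hs.1 hs.2.1 hR h1 ?_
  rw [← comp_eq, ← comp_eq, hs.2.2, h]

theorem sqrtOp_L_spec : (∀ n : ℤ, 1 < n → sqrtOp L n = 0) ∧ sqrtOp L 1 = 1 ∧
    comp (sqrtOp L) (sqrtOp L) = L := by
  have h := comp_leading (d := 0) (d' := 2) Binv_spec.1 (fun n hn => A_of_two_lt hn)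
  rw [Binv_zero, A_two, map_one, mul_one] at h
  exact sqrtOp_spec h.1 h.2

/-- `L^{1/2}` in the ring of operators with bounded positive powers. -/
def opSqrt : Ops sh 1 := ⟨sqrtOp L, mem_boundedOps_of_lt (d := 1) fun n hn =>
  sqrtOp_L_spec.1 n (by simpa using hn)⟩

theorem opSqrt_mul_self : opSqrt * opSqrt = opBinv * opA 1 :=
  Ops.coeff_injective ((comp_eq _ _).symm.trans (sqrtOp_L_spec.2.2.trans coeff_opBinv_mul_opA.symm))

/-- L̃ = BLB⁻¹, and conjugation by B keeps the leading term Λ, so uniqueness makes the root of L̃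
the conjugate of the root of L. -/
theorem sqrtOp_Ltilde : sqrtOp Ltilde = (opB 1 * opSqrt * opBinv).coeff := by
  have hS := sqrtOp_L_spec
  have h1 := comp_leading (d := 0) (d' := 1) (fun n hn => B_of_pos hn) hS.1
  have h2 := comp_leading (d := 0 + 1) (d' := 0) h1.1 Binv_spec.1
  rw [h1.2, B_zero, hS.2.1, Binv_zero, map_one, map_one, mul_one, mul_one] at h2
  have hc : (opB 1 * opSqrt * opBinv).coeff = comp (comp B (sqrtOp L)) Binv := by
    rw [comp_eq, comp_eq]
    rfl
  rw [hc]
  refine sqrtOp_eq h2.1 h2.2 ?_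
  rw [← hc, comp_eq, ← coeff_opA_mul_opBinv]
  have : opB 1 * opSqrt * opBinv * (opB 1 * opSqrt * opBinv) = opA 1 * opBinv := by
    calc opB 1 * opSqrt * opBinv * (opB 1 * opSqrt * opBinv)
        = opB 1 * opSqrt * (opBinv * opB 1) * opSqrt * opBinv := by simp only [mul_assoc]
      _ = opB 1 * (opSqrt * opSqrt) * opBinv := by rw [opBinv_mul_opB, mul_one]; simp only [mul_assoc]
      _ = opB 1 * opBinv * opA 1 * opBinv := by rw [opSqrt_mul_self]; simp only [mul_assoc]
      _ = opA 1 * opBinv := by rw [opB_mul_opBinv, one_mul]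
  exact congrArg Ops.coeff this

section RingIdentities

variable {O : Type*} [Ring O]

theorem conj_pow_of_mul_eq_one {B B' : O} (hB : B * B' = 1) (hB' : B' * B = 1) (S : O) (n : ℕ) :
    (B * S * B') ^ n = B * S ^ n * B' := by
  induction n with
  | zero => rw [pow_zero, pow_zero, mul_one, hB]
  | succ n ih =>
    calc (B * S * B') ^ (n + 1) = B * S ^ n * (B' * B) * S * B' := by
          rw [pow_succ, ih]; simp only [mul_assoc]
      _ = B * S ^ (n + 1) * B' := by rw [hB', mul_one, pow_succ]; simp only [mul_assoc]

theorem mul_pow_succ_eq (A' B : O) (n : ℕ) : (B * A') ^ (n + 1) = B * (A' * B) ^ n * A' := by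
  induction n with
  | zero => simp
  | succ n ih => rw [pow_succ, ih, pow_succ]; simp only [mul_assoc]

end RingIdentities

theorem Factorization.of_ops {e : ℤˣ} {X X' Z W : Ops sh e} (h1 : Z * opA e = X)
    (h2 : opA e * Z = X') (h3 : W * opB e = X) (h4 : opB e * W = X') :
    Factorization X.coeff X'.coeff Z.coeff W.coeff where
  comp_Z_A := (comp_eq _ _).trans (congrArg Ops.coeff h1)
  comp_A_Z := (comp_eq _ _).trans (congrArg Ops.coeff h2)
  comp_W_B := (comp_eq _ _).trans (congrArg Ops.coeff h3)
  comp_B_W := (comp_eq _ _).trans (congrArg Ops.coeff h4)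
  comp_A := by
    rw [comp_eq, comp_eq]
    exact congrArg Ops.coeff (show X' * opA e = opA e * X by rw [← h2, mul_assoc, h1])
  comp_B := by
    rw [comp_eq, comp_eq]
    exact congrArg Ops.coeff (show X' * opB e = opB e * X by rw [← h4, mul_assoc, h3])

/-- The only relation that is not immediate is AZ = X': writing A = BS² moves S² across S^n, and
S²A⁻¹ = B⁻¹. -/
theorem factorization_sqrt {A' : Ops sh 1} (hA : opA 1 * A' = 1) (hA' : A' * opA 1 = 1) (n : ℕ) :
    Factorization (opSqrt ^ n).coeff ((opB 1 * opSqrt * opBinv) ^ n).coeff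
      (opSqrt ^ n * A').coeff (opSqrt ^ n * opBinv).coeff := by
  have hS := opSqrt_mul_self
  refine Factorization.of_ops ?_ ?_ ?_ ?_
  · rw [mul_assoc, hA', mul_one]
  · have h1 : opA 1 = opB 1 * (opSqrt * opSqrt) := by
      rw [hS, ← mul_assoc, opB_mul_opBinv, one_mul]
    have h2 : opSqrt * opSqrt * A' = opBinv := by rw [hS, mul_assoc, hA, mul_one]
    rw [conj_pow_of_mul_eq_one opB_mul_opBinv opBinv_mul_opB]
    calc opA 1 * (opSqrt ^ n * A') = opB 1 * (opSqrt ^ 2 * opSqrt ^ n) * A' := by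
          rw [h1, pow_two]; simp only [mul_assoc]
      _ = opB 1 * opSqrt ^ n * (opSqrt * opSqrt * A') := by
          rw [← pow_add, add_comm, pow_add, pow_two]; simp only [mul_assoc]
      _ = opB 1 * opSqrt ^ n * opBinv := by rw [h2]
  · rw [mul_assoc, opBinv_mul_opB, mul_one]
  · rw [conj_pow_of_mul_eq_one opB_mul_opBinv opBinv_mul_opB, mul_assoc]

/-- Here W = M^nA⁻¹ plays the role of M^{n+1}B⁻¹, so no inverse of B in ascending powers of Λ is
needed. -/
theorem factorization_quotient (n : ℕ) :
    Factorization ((opAinv * opB (-1)) ^ (n + 1)).coeff ((opB (-1) * opAinv) ^ (n + 1)).coeff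
      ((opAinv * opB (-1)) ^ (n + 1) * opAinv).coeff ((opAinv * opB (-1)) ^ n * opAinv).coeff := by
  refine Factorization.of_ops ?_ ?_ ?_ ?_
  · rw [mul_assoc, opAinv_mul_opA, mul_one]
  · rw [mul_pow_succ_eq opAinv (opB (-1)), pow_succ', ← mul_assoc, ← mul_assoc, ← mul_assoc, opA_mul_opAinv, one_mul]
  · rw [pow_succ, mul_assoc]
  · rw [mul_pow_succ_eq opAinv (opB (-1)), mul_assoc]

/-! ### The theorem for each family of flows -/

/-- The flows with the positive part of a power of `L^{1/2}`. -/
theorem flow_sqrt {c κ : ℝ} {n : ℕ} (hκ : 2 * κ = ((n + 1 : ℕ) : ℝ)) :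
    (∃! T, LaxPair c (posPart (opPow (sqrtOp Ltilde) (n + 1)))
      (posPart (opPow (sqrtOp L) (n + 1))) T) ∧
    ∀ T, LaxPair c (posPart (opPow (sqrtOp Ltilde) (n + 1)))
      (posPart (opPow (sqrtOp L) (n + 1))) T ↔
      ∀ α, κ • (eps * T α)
        = ∑ β, P2 α β (varDeriv β (c • res (opPow (sqrtOp L) (n + 1)))) := by
  -- This inverse of A descends in powers of Λ, unlike `Ainv`. It enters only through `gradVec` and
  -- is absent from the final equation.
  obtain ⟨A', hA, hA'⟩ := exists_opA_inverse
  have hS : opPow (sqrtOp L) (n + 1) = (opSqrt ^ (n + 1)).coeff := opPow_eq opSqrt (n + 1)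
  have hS' : opPow (sqrtOp Ltilde) (n + 1) = ((opB 1 * opSqrt * opBinv) ^ (n + 1)).coeff := by
    rw [sqrtOp_Ltilde, opPow_eq]
  rw [hS, hS']
  have hκ0 : κ ≠ 0 := by
    rintro rfl
    have : ((n + 1 : ℕ) : ℝ) ≠ 0 := Nat.cast_ne_zero.2 (Nat.succ_ne_zero n)
    exact this (by rw [← hκ, mul_zero])
  refine flow_of_iff hκ0 ((factorization_sqrt hA hA' (n + 1)).laxPair_posPart_iff c) fun α => ?_
  have h := varDeriv_res_sqrt_pow α hA hA' opB_mul_opBinv opBinv_mul_opB opSqrt_mul_self n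
  rw [← hκ, mul_smul] at h
  rw [varDeriv_smul, smul_right_injective _ (two_ne_zero' ℝ) h, smul_smul, mul_comm]

/-- The flows with the negative part of a power of `M`. -/
theorem flow_quotient {c : ℝ} {n : ℕ} :
    (∃! T, LaxPair c (negPart (opPow Mtilde (n + 1))) (negPart (opPow M (n + 1))) T) ∧
    ∀ T, LaxPair c (negPart (opPow Mtilde (n + 1))) (negPart (opPow M (n + 1))) T ↔
      ∀ α, (-((n + 1 : ℕ) : ℝ)) • (eps * T α)
        = ∑ β, P2 α β (varDeriv β ((-c) • res (opPow M (n + 1)))) := by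
  have hM : opPow M (n + 1) = ((opAinv * opB (-1)) ^ (n + 1)).coeff := by
    rw [← coeff_opAinv_mul_opB, opPow_eq]
  have hM' : opPow Mtilde (n + 1) = ((opB (-1) * opAinv) ^ (n + 1)).coeff := by
    rw [← coeff_opB_mul_opAinv, opPow_eq]
  rw [hM, hM']
  refine flow_of_iff (neg_ne_zero.2 (Nat.cast_ne_zero.2 (Nat.succ_ne_zero n)))
    ((factorization_quotient n).laxPair_negPart_iff c) fun α => ?_
  rw [varDeriv_smul, varDeriv_res_quotient_pow α opA_mul_opAinv opAinv_mul_opA n, smul_smul,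
    mul_comm]

/-- With this, the integer powers of L are covered by the statement on powers of its root. -/
theorem opPow_sqrtOp_two_mul (n : ℕ) : opPow (sqrtOp L) (2 * n) = opPow L n := by
  have h : opPow (sqrtOp L) (2 * n) = (opSqrt ^ (2 * n)).coeff := opPow_eq opSqrt (2 * n)
  rw [h, pow_mul, pow_two, opSqrt_mul_self, ← opPow_eq, coeff_opBinv_mul_opA]

theorem opPow_sqrtOp_Ltilde_two_mul (n : ℕ) : opPow (sqrtOp Ltilde) (2 * n) = opPow Ltilde n := by
  have h : (opB 1 * opSqrt * opBinv) ^ 2 = opA 1 * opBinv := by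
    rw [conj_pow_of_mul_eq_one opB_mul_opBinv opBinv_mul_opB, pow_two, opSqrt_mul_self, ← mul_assoc,
      opB_mul_opBinv, one_mul]
  rw [sqrtOp_Ltilde, opPow_eq, pow_mul, h, ← opPow_eq, coeff_opA_mul_opBinv]

theorem basePartial_baseLog (p : U) :
    basePartial 0 baseLog p = 0 ∧ basePartial 1 baseLog p = -((p : Vals) 1)⁻¹ ∧
      basePartial 2 baseLog p = ((p : Vals) 2)⁻¹ := by
  have hp1 : (p : Vals) 1 ≠ 0 := p.2.1
  have hp2 : (p : Vals) 2 ≠ 0 := p.2.2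
  -- On U, log|w/v| = log|w| - log|v|, whatever the signs of v and w.
  have hlog : HasFDerivAt (fun q : Vals => Real.log (q 2 / q 1))
      ((((p : Vals) 2)⁻¹) • ContinuousLinearMap.proj (R := ℝ) (φ := fun _ : Fin 3 => ℝ) 2
        - (((p : Vals) 1)⁻¹) • ContinuousLinearMap.proj (R := ℝ) (φ := fun _ : Fin 3 => ℝ) 1)
      (p : Vals) := by
    have h1 : HasFDerivAt (fun q : Vals => Real.log (q 1)) _ (p : Vals) :=
      (hasFDerivAt_apply (𝕜 := ℝ) 1 (p : Vals)).log hp1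
    have h2 : HasFDerivAt (fun q : Vals => Real.log (q 2)) _ (p : Vals) :=
      (hasFDerivAt_apply (𝕜 := ℝ) 2 (p : Vals)).log hp2
    refine (h2.sub h1).congr_of_eventuallyEq ?_
    filter_upwards [U.isOpen.mem_nhds p.2] with q hq
    exact Real.log_div hq.2 hq.1
  have key : ∀ α, basePartial α baseLog p = ((p : Vals) 2)⁻¹ * Pi.single (M := fun _ => ℝ) α 1 2
      - ((p : Vals) 1)⁻¹ * Pi.single (M := fun _ => ℝ) α 1 1 := fun α => by
    rw [basePartial_eq_of_eq (g := fun q : Vals => Real.log (q 2 / q 1)) (fun q => rfl),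
      hlog.fderiv]
    rfl
  refine ⟨?_, ?_, ?_⟩ <;> rw [key] <;> simp

theorem ofSymbol_apply_one (φ : PowerSeries ℝ) (h : PowerSeries.coeff 0 φ = 0) :
    ofSymbol φ 1 = 0 := by
  rw [ofSymbol_eq, ← map_one PowerSeries.C, symOp_of_deriv_eq_zero _ _ (by simp), h, zero_smul]

/-- The functional `∫ log (w / v) dx` is a Casimir of `𝒫₂`. -/
theorem sum_P2_varDeriv_log (α : Fin 3) :
    ∑ β, P2 α β (varDeriv β (ofSmooth baseLog)) = 0 := by
  have h0 : varDeriv 0 (ofSmooth baseLog) = 0 := by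
    rw [varDeriv_ofSmooth, show basePartial 0 baseLog = 0 from
      ContMDiffMap.ext fun p => (basePartial_baseLog p).1]
    simp [ofSmooth]
  have h1 : v * varDeriv 1 (ofSmooth baseLog) = -1 := by
    have : baseCoord 1 * basePartial 1 baseLog = -1 := by
      ext p
      change (p : Vals) 1 * basePartial 1 baseLog p = -1
      rw [(basePartial_baseLog p).2.1, mul_neg, mul_inv_cancel₀ p.2.1]
    rw [varDeriv_ofSmooth, v, coord, ofSmooth, ofSmooth, ← map_mul, ← map_mul, this]
    simp
  have h2 : w * varDeriv 2 (ofSmooth baseLog) = 1 := by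
    have : baseCoord 2 * basePartial 2 baseLog = 1 := by
      ext p
      change (p : Vals) 2 * basePartial 2 baseLog p = 1
      rw [(basePartial_baseLog p).2.2, mul_inv_cancel₀ p.2.2]
    rw [varDeriv_ofSmooth, w, coord, ofSmooth, ofSmooth, ← map_mul, ← map_mul, this]
    simp
  -- The gradient g has g_u = 0, v g_v = -1 and w g_w = 1. Each symbol acting on these constants
  -- vanishes at z = 0, and so annihilates them.
  have e1 : PowerSeries.coeff 0 ((expSymbol 1 - 1) * (1 + expSymbol (-1))⁻¹) = 0 := by
    rw [coeff_zero_mul_eq, map_sub, coeff_zero_expSymbol, PowerSeries.coeff_zero_one, sub_self,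
      zero_mul]
  have e2 : PowerSeries.coeff 0 ((expSymbol 2 - expSymbol (-1)) * (expSymbol 1 + 1)⁻¹) = 0 := by
    rw [coeff_zero_mul_eq, map_sub, coeff_zero_expSymbol, coeff_zero_expSymbol, sub_self, zero_mul]
  fin_cases α
  · refine (sum_P2_zero _).trans ?_
    rw [h0, h2, ofSymbol_apply_one _ e1]
    simp
  · refine (sum_P2_one _).trans ?_
    rw [h2, map_one, sub_self, mul_zero]
  · refine (sum_P2_two _).trans ?_
    rw [h0, h1, h2, ofSymbol_apply_one _ e2, map_neg, map_one]
    simp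

/-- The exponent 2n+1 of the root gives κ = (2n+1)/2 = n + μ₂ + 1/2, and the constant of the flow
equals that of the density of H_{2,n-1}. -/
theorem flow_two (n : ℕ) : (∃! T, IsFlow .two n T) ∧
    ∀ T, IsFlow .two n T ↔ SecondHamEq .two n T := by
  have h := flow_sqrt (c := (2 : ℝ) ^ ((n : ℝ) + 1 / 2) / ((2 * n + 1).doubleFactorial : ℝ))
    (κ := (n : ℝ) + 0 + 1 / 2) (n := 2 * n) (by push_cast; ring)
  have hn : (2 * ((n : ℤ) - 1) + 3).toNat = 2 * n + 1 := by omega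
  have he : (((n : ℤ) - 1 : ℤ) : ℝ) + 3 / 2 = (n : ℝ) + 1 / 2 := by push_cast; ring
  simpa only [IsFlow, SecondHamEq, hamDensity, mu, Int.toNat_natCast, Int.cast_natCast, hn, he]
    using h

theorem flow_three (n : ℕ) : (∃! T, IsFlow .three n T) ∧
    ∀ T, IsFlow .three n T ↔ SecondHamEq .three n T := by
  have h := flow_sqrt (c := 1 / ((n + 1).factorial : ℝ))
    (κ := (n : ℝ) + 1 / 2 + 1 / 2) (n := 2 * n + 1) (by push_cast; ring)
  have hn : ((n : ℤ) - 1 + 2).toNat = n + 1 := by omega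
  rw [show 2 * n + 1 + 1 = 2 * (n + 1) by ring, opPow_sqrtOp_two_mul,
    opPow_sqrtOp_Ltilde_two_mul] at h
  simpa only [IsFlow, SecondHamEq, hamDensity, mu, Int.toNat_natCast, Int.cast_natCast, hn]
    using h

/-- For k = -(n+1) the factor k + μ₀ + 1/2 is -(n+1), and the density of H_{0,k-1} carries minus the
constant of the flow. The latter sign is the one produced by using negative parts. -/
theorem flow_zero_neg (n : ℕ) : (∃! T, IsFlow .zero (-((n + 1 : ℕ) : ℤ)) T) ∧
    ∀ T, IsFlow .zero (-((n + 1 : ℕ) : ℤ)) T ↔ SecondHamEq .zero (-((n + 1 : ℕ) : ℤ)) T := by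
  have h := flow_quotient (c := (-1) ^ n * (n.factorial : ℝ)) (n := n)
  have h0 : (-((n + 1 : ℕ) : ℤ)) ≠ 0 := by omega
  have h1 : -((n + 1 : ℕ) : ℤ) - 1 ≠ -1 := by omega
  have h2 : (- -((n + 1 : ℕ) : ℤ)).toNat = n + 1 := by omega
  have h3 : (-(-((n + 1 : ℕ) : ℤ) - 1) - 1).toNat = n + 1 := by omega
  have h4 : ((-((n + 1 : ℕ) : ℤ) : ℤ) : ℝ) + -1 / 2 + 1 / 2 = -((n + 1 : ℕ) : ℝ) := by
    push_cast; ring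
  have h5 : (-1 : ℝ) ^ (n + 1) * (n.factorial : ℝ) = -((-1) ^ n * (n.factorial : ℝ)) := by ring
  simpa only [IsFlow, SecondHamEq, hamDensity, mu, if_neg h0, if_neg h1, h2, h3, h4,
    Nat.add_sub_cancel, h5] using h

/-- Both sides vanish: 0 + μ₀ + 1/2 = 0, and the Hamiltonian is a Casimir. The equation thus puts no
condition on T, which is why the converse excludes this case. -/
theorem secondHamEq_zero_zero (T : Fin 3 → EpsRing) : SecondHamEq .zero 0 T := by
  intro α
  have h : hamDensity .zero (0 - 1) = ofSmooth baseLog := by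
    simp [hamDensity]
  rw [h, sum_P2_varDeriv_log]
  norm_num [mu]

end RR2T

end

/-! ### Assembly of the cases -/

theorem mainTheorem2 (i : RR2T.Label) (k : ℤ)
    (hik : ((i = .two ∨ i = .three) ∧ 0 ≤ k) ∨ (i = .zero ∧ k ≤ 0)) :
    (∃! T : Fin 3 → RR2T.EpsRing, RR2T.IsFlow i k T) ∧
      (∀ T : Fin 3 → RR2T.EpsRing, RR2T.IsFlow i k T → RR2T.SecondHamEq i k T) ∧
      (¬(i = .zero ∧ k = 0) →
        ∀ T : Fin 3 → RR2T.EpsRing, RR2T.SecondHamEq i k T → RR2T.IsFlow i k T) := by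
  rcases hik with ⟨rfl | rfl, hk⟩ | ⟨rfl, hk⟩
  · lift k to ℕ using hk
    have h := RR2T.flow_two k
    exact ⟨h.1, fun T => (h.2 T).1, fun _ T => (h.2 T).2⟩
  · lift k to ℕ using hk
    have h := RR2T.flow_three k
    exact ⟨h.1, fun T => (h.2 T).1, fun _ T => (h.2 T).2⟩
  · rcases eq_or_lt_of_le hk with rfl | hk
    · refine ⟨⟨fun α => RR2T.dxEps (RR2T.coord α), fun α => rfl, fun T hT => funext hT⟩,
        fun T _ => RR2T.secondHamEq_zero_zero T, fun h => absurd ⟨rfl, rfl⟩ h⟩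
    · obtain ⟨n, rfl⟩ : ∃ n : ℕ, k = -((n + 1 : ℕ) : ℤ) := ⟨(-k - 1).toNat, by omega⟩
      have h := RR2T.flow_zero_neg n
      exact ⟨h.1, fun T => (h.2 T).1, fun _ T => (h.2 T).2⟩
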